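/- Let $X$ be a reflexive real Banach space with a topological direct sum decomposition $X=X^+\oplus\widetilde X$, written $u=u^++\widetilde u$, where $X^+$ is an infinite-dimensional Hilbert space and $\|u\|^2=\|u^+\|^2+\|\widetilde u\|^2$. Write $u_n\xrightarrow{\mathcal T}u$ if $u_n^+\to u^+$ in norm and $\widetilde u_n\rightharpoonup\widetilde u$ weakly. Let $\mathcal J(u)=\frac12\|u^+\|^2-\mathcal I(u)$ with $\mathcal I:X\to\mathbb R$, and put $$\mathcal M=\{u\in X:\mathcal J'(u)|_{\widetilde X}=0\},\qquad \mathcal N=\{u\in X\setminus\widetilde X:\mathcal J'(u)|_{\mathbb Ru\oplus\widetilde X}=0\}.$$ Assume: (I1) $\mathcal I\in C^1(X,\mathbb R)$ and $\mathcal I(u)\ge\mathcal I(0)=0$ for all $u\in X$. (I2) If $u_n\xrightarrow{\mathcal T}u$, then $\liminf\mathcal I(u_n)\ge\mathcal I(u)$. (I3) If $u_n\xrightarrow{\mathcal T}u$ and $\mathcal I(u_n)\to\mathcal I(u)$, then $u_n\to u$ in norm. (I4) $\|u^+\|+\mathcal I(u)\to\infty$ as $\|u\|\to\infty$. (I5)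 If $u\in\mathcal M$, then $\mathcal I(u)<\mathcal I(u+v)$ for every $v\in\widetilde X\setminus\{0\}$. (I6) $r>0$ is such that $\inf\{\mathcal J(u):u\in X^+,\ \|u\|=r\}>0$. (I7) $\mathcal I(t_nu_n)/t_n^2\to\infty$ whenever $t_n\to\infty$ and $u_n^+\to u^+\neq0$. (I8) $\frac{t^2-1}2\mathcal I'(u)[u]+t\,\mathcal I'(u)[v]+\mathcal I(u)-\mathcal I(tu+v)\le0$ for all $u\in\mathcal N$, $t\ge0$, $v\in\widetilde X$. For $u\in X^+$ let $m(u)$ be the unique point of $\mathcal M$ with $m(u)^+=u$, and let $\widetilde{\mathcal J}=\mathcal J\circ m:X^+\to\mathbb R$. Let $$c_{\mathcal M}=\inf_{\gamma\in\Gamma}\ \sup_{t\in[0,1]}\mathcal J(\gamma(t)),\qquad \Gamma=\{\gamma\in C([0,1],\mathcal M):\gamma(0)=0,\ \|\gamma(1)^+\|>r,\ \mathcal J(\gamma(1))<0\}.$$ Let a group $G$ act on $X$ by isometries, such that for each $u\ne0$ the set $(G*u)\setminus\{u\}$ is bounded away from $u$ (where $G*u$ is the orbit of $u$), and such that $\mathcal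 J$, $X^+$ and $\widetilde X$ are $G$-invariant. For $\alpha\le\beta$ let $(M)_\alpha^\beta$ denote the conjunction of the following two conditions on sequences $(u_n)\subset X^+$ such that $$(*)\qquad \alpha\le\liminf\widetilde{\mathcal J}(u_n)\le\limsup\widetilde{\mathcal J}(u_n)\le\beta,\qquad (1+\|u_n\|)\widetilde{\mathcal J}'(u_n)\to0:$$ (i) there is a constant $M_\alpha^\beta$ such that $\limsup\|u_n\|\le M_\alpha^\beta$ for every $(u_n)$ satisfying $(*)$; (ii) if the set $\{u\in X^+:\alpha\le\widetilde{\mathcal J}(u)\le\beta\}$ contains only finitely many $G$-orbits of critical points of $\widetilde{\mathcal J}$, then there is $m_\alpha^\beta>0$ such that $\liminf\|u_n-v_n\|=0$ whenever $(u_n)$, $(v_n)$ both satisfy $(*)$ and $\|u_n-v_n\|<m_\alpha^\beta$ for all large $n$. Then: (a) If $(M)_0^{c_{\mathcal M}+\varepsilon}$ holds for arbitrarily small $\varepsilon>0$ (that is, for every $\varepsilon_0>0$ it holds for some $\varepsilon\in(0,\varepsilon_0]$), then either $c_{\mathcal M}$ is attained by a critical point of $\mathcal J$, i.e. there is $u\in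 X$ with $\mathcal J'(u)=0$ and $\mathcal J(u)=c_{\mathcal M}$, or there is a sequence of critical values $c_n$ of $\mathcal J$ such that $c_n>c_{\mathcal M}$ for all $n$ and $c_n\to c_{\mathcal M}$. (b) If $(M)_0^\beta$ holds for every $\beta>0$ and $\mathcal J$ is even, then the critical points of $\mathcal J$ form infinitely many distinct $G$-orbits. -/

import Mathlib

open Filter Topology

noncomputable section

namespace StronglyIndefinite

/-- The space `X = X⁺ ⊕ X̃`, with `X⁺ = H` a Hilbert space and `X̃ = Y` a Banach space, normed by
`‖u‖² = ‖u⁺‖² + ‖ũ‖²`.  For `u : Space H Y` the summands are `u⁺ = u.fst` and `ũ = u.snd`. -/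
abbrev Space (H Y : Type*) := WithLp 2 (H × Y)

/-- A real normed space is reflexive when the canonical map into its bidual is onto. -/
def IsReflexive (E : Type*) [NormedAddCommGroup E] [NormedSpace ℝ E] : Prop :=
  Function.Surjective (NormedSpace.inclusionInDoubleDual ℝ E)

section Functional

variable {H Y : Type*} [NormedAddCommGroup H] [InnerProductSpace ℝ H]
  [NormedAddCommGroup Y] [NormedSpace ℝ Y]

/-- The element `u + v` of `X`, where `u ∈ X⁺` and `v ∈ X̃`. -/
abbrev pair (u : H) (v : Y) : Space H Y := WithLp.toLp 2 (u, v)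

/-- Sequential convergence for the product of the norm topology of `X⁺` and the weak topology
of `X̃`. -/
def TendstoT (u : ℕ → Space H Y) (w : Space H Y) : Prop :=
  Tendsto (fun n => (u n).fst) atTop (𝓝 w.fst) ∧
    ∀ φ : Y →L[ℝ] ℝ, Tendsto (fun n => φ (u n).snd) atTop (𝓝 (φ w.snd))

/-- `𝒥(u) = ‖u⁺‖² / 2 - ℐ(u)`. -/
def functional (I : Space H Y → ℝ) (u : Space H Y) : ℝ :=
  ‖u.fst‖ ^ 2 / 2 - I u

/-- `ℳ`: the points at which the derivative of `𝒥` vanishes on `X̃`. -/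
def setM (I : Space H Y → ℝ) : Set (Space H Y) :=
  {u | ∀ v : Y, fderiv ℝ (functional I) u (pair 0 v) = 0}

/-- `𝒩`: the points of `X ∖ X̃` at which the derivative of `𝒥` vanishes on `ℝ u ⊕ X̃`. -/
def setN (I : Space H Y → ℝ) : Set (Space H Y) :=
  {u | u.fst ≠ 0 ∧ ∀ (s : ℝ) (v : Y), fderiv ℝ (functional I) u (s • u + pair 0 v) = 0}

/-- The conditions (I1)-(I8) on `ℐ`; the radius `r` is the one of (I6). -/
structure Conditions (I : Space H Y → ℝ) (r : ℝ) : Prop where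
  i1_contDiff : ContDiff ℝ 1 I
  i1_zero : I 0 = 0
  i1_nonneg : ∀ u, 0 ≤ I u
  i2 : ∀ (u : ℕ → Space H Y) (w : Space H Y), TendstoT u w →
    (I w : EReal) ≤ liminf (fun n => (I (u n) : EReal)) atTop
  i3 : ∀ (u : ℕ → Space H Y) (w : Space H Y), TendstoT u w →
    Tendsto (fun n => I (u n)) atTop (𝓝 (I w)) → Tendsto u atTop (𝓝 w)
  i4 : Tendsto (fun u : Space H Y => ‖u.fst‖ + I u) (Bornology.cobounded (Space H Y)) atTop
  i5 : ∀ u ∈ setM I, ∀ v : Y, v ≠ 0 → I u < I (u + pair 0 v)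
  i6_pos : 0 < r
  i6 : ∃ a : ℝ, 0 < a ∧ ∀ u : H, ‖u‖ = r → a ≤ functional I (pair u 0)
  i7 : ∀ (t : ℕ → ℝ) (u : ℕ → Space H Y) (w : H), Tendsto t atTop atTop →
    Tendsto (fun n => (u n).fst) atTop (𝓝 w) → w ≠ 0 →
    Tendsto (fun n => I (t n • u n) / t n ^ 2) atTop atTop
  i8 : ∀ u ∈ setN I, ∀ t : ℝ, 0 ≤ t → ∀ v : Y,
    (t ^ 2 - 1) / 2 * fderiv ℝ I u u + t * fderiv ℝ I u (pair 0 v)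
      + I u - I (t • u + pair 0 v) ≤ 0

/-- `Γ`: the paths in `ℳ` from `0` to a point `w` with `‖w⁺‖ > r` and `𝒥(w) < 0`. -/
def pathsM (I : Space H Y → ℝ) (r : ℝ) : Set C(unitInterval, Space H Y) :=
  {γ | (∀ t, γ t ∈ setM I) ∧ γ 0 = 0 ∧ r < ‖(γ 1).fst‖ ∧ functional I (γ 1) < 0}

/-- The mountain pass level `c_ℳ`. -/
def levelM (I : Space H Y → ℝ) (r : ℝ) : ℝ :=
  ⨅ γ : pathsM I r, ⨆ t : unitInterval, functional I (γ.1 t)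

/-- `m(u)`, the point of `ℳ` whose `X⁺`-component is `u`.  Under (I1)-(I5) there is exactly one
such point. -/
def mapM (I : Space H Y → ℝ) (u : H) : Space H Y :=
  pair u (Classical.epsilon fun v : Y => pair u v ∈ setM I)

/-- The reduced functional `𝒥̃ = 𝒥 ∘ m` on `X⁺`. -/
def reduced (I : Space H Y → ℝ) (u : H) : ℝ :=
  functional I (mapM I u)

/-- `α ≤ liminf 𝒥̃(uₙ) ≤ limsup 𝒥̃(uₙ) ≤ β` and `(1 + ‖uₙ‖) 𝒥̃'(uₙ) → 0`. -/
def IsCeramiBetween (I : Space H Y → ℝ) (α β : ℝ) (u : ℕ → H) : Prop :=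
  (α : EReal) ≤ liminf (fun n => (reduced I (u n) : EReal)) atTop ∧
  limsup (fun n => (reduced I (u n) : EReal)) atTop ≤ (β : EReal) ∧
  Tendsto (fun n => (1 + ‖u n‖) • fderiv ℝ (reduced I) (u n)) atTop (𝓝 0)

/-- `u` is a critical point of `𝒥`. -/
def IsCritical (I : Space H Y → ℝ) (u : Space H Y) : Prop :=
  fderiv ℝ (functional I) u = 0

/-- `c` is a critical value of `𝒥`. -/
def IsCriticalValue (I : Space H Y → ℝ) (c : ℝ) : Prop :=
  ∃ u, IsCritical I u ∧ functional I u = c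

section Group

variable (G : Type*) [Group G] [MulAction G (Space H Y)]

/-- `G` acts on `X` by isometries and discretely, and leaves `𝒥`, `X⁺` and `X̃` invariant. -/
structure ActsDiscretely (I : Space H Y → ℝ) : Prop where
  isometry : ∀ g : G, Isometry fun u : Space H Y => g • u
  discrete : ∀ u : Space H Y, u ≠ 0 →
    ∃ δ : ℝ, 0 < δ ∧ ∀ w ∈ MulAction.orbit G u, w ≠ u → δ ≤ ‖w - u‖
  invariant : ∀ (g : G) (u : Space H Y), functional I (g • u) = functional I u
  invariant_plus : ∀ (g : G) (u : Space H Y), u.snd = 0 → (g • u).snd = 0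
  invariant_tilde : ∀ (g : G) (u : Space H Y), u.fst = 0 → (g • u).fst = 0

/-- The `G`-orbits of the critical points `u ∈ X⁺` of `𝒥̃` with `α ≤ 𝒥̃(u) ≤ β`. -/
def reducedCriticalOrbits (I : Space H Y → ℝ) (α β : ℝ) : Set (Set (Space H Y)) :=
  {O | ∃ u : H, fderiv ℝ (reduced I) u = 0 ∧ α ≤ reduced I u ∧ reduced I u ≤ β ∧
    O = MulAction.orbit G (pair u 0 : Space H Y)}

/-- The condition `(M)_α^β`. -/
structure ConditionM (I : Space H Y → ℝ) (α β : ℝ) : Prop where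
  bounded : ∃ M : ℝ, ∀ u : ℕ → H, IsCeramiBetween I α β u →
    limsup (fun n => (‖u n‖ : EReal)) atTop ≤ (M : EReal)
  discrete : (reducedCriticalOrbits G I α β).Finite →
    ∃ m : ℝ, 0 < m ∧ ∀ u v : ℕ → H, IsCeramiBetween I α β u → IsCeramiBetween I α β v →
      (∀ᶠ n in atTop, ‖u n - v n‖ < m) →
      liminf (fun n => (‖u n - v n‖ : EReal)) atTop = 0

/-- The `G`-orbits of the critical points of `𝒥`. -/
def criticalOrbits (I : Space H Y → ℝ) : Set (Set (Space H Y)) :=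
  {O | ∃ u, IsCritical I u ∧ O = MulAction.orbit G u}

end Group

end Functional

end StronglyIndefinite

end

/-! Minimizing ℐ on the fibres u + X̃ removes the indefinite directions. A minimizer exists by
reflexivity, (I4) and (I2), it is unique by (I5), and (I3) makes m continuous. Since 𝒥(m(u)) is the
maximum of 𝒥 over the fibre, 𝒥̃ = 𝒥 ∘ m is C¹ although m is merely shown to be continuous
(`Conditions.hasFDerivAt_reduced`), and its critical points correspond to those of 𝒥. By (I6) and
(I7), 𝒥̃ has mountain pass geometry; by (I8), nontrivial critical points have energy at least c_ℳ.

The derivative of 𝒥̃ is only continuous, so iterates of one continuous map with variable step size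
replace a gradient flow (`exists_descent_map`). When the critical orbits are finite in number, (M)
says that almost critical points are bounded and that two of them closer than m are in fact
arbitrarily close. Leaving the neighbourhood of one of them then costs a fixed amount of energy
(`energy_le_of_crossing`), so a trajectory of bounded energy that is never cut off accumulates at a
critical point.

For (a): if the critical values of 𝒥 avoid [c_ℳ, c_ℳ + ε], the descent carries a nearly optimal path
below c_ℳ/2, a contradiction.

For (b): finitely many orbits give finitely many critical values, at most p say. Map the ball of
ℝ^(p+1) linearly into X⁺ so that 𝒥̃ < 0 on the image of its boundary. Select one point from each
antipodal pair of critical points of positive level. The starting points whose trajectories come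
near a selected point of a given level form an open set, disjoint from its antipode because no
trajectory visits two critical points of one level (`IsDescentStep.not_visits_two`). All other
starting points descend below the energy of the sphere ‖u‖ = r within N steps. The points sent to
that sphere by N steps thus separate the origin from the boundary and are covered by p antipodal
pairs of open sets. A mod 2 cochain computation forbids this (`borsuk_ulam_separation`). -/

noncomputable section

namespace StronglyIndefinite

set_option linter.unusedSectionVars false

/-! ### Weak sequential compactness in reflexive spaces -/

section WeakCompactness

variable {E : Type*} [NormedAddCommGroup E] [NormedSpace ℝ E]

/-- In a reflexive space bounded sequences have weakly convergent subsequences. -/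
lemma IsReflexive.exists_weakly_convergent_subseq (hE : IsReflexive E) {x : ℕ → E} {C : ℝ}
    (hx : ∀ n, ‖x n‖ ≤ C) :
    ∃ (w : E) (k : ℕ → ℕ), StrictMono k ∧
      ∀ f : E →L[ℝ] ℝ, Tendsto (fun n => f (x (k n))) atTop (𝓝 (f w)) := by
  let e := toWeakSpace ℝ E
  let S : Set (WeakSpace ℝ E) := Set.range fun n => e (x n)
  have hcpt : IsCompact (closure S) := by
    refine NormedSpace.isCompact_closure_of_isBounded ℝ E S ?_ ?_
    · refine (Metric.isBounded_closedBall (x := (0 : E)) (r := C)).subset ?_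
      rintro y ⟨n, hn⟩
      have : x n = y := e.injective hn
      rw [mem_closedBall_zero_iff, ← this]
      exact hx n
    · intro y _
      obtain ⟨z, hz⟩ := hE y
      exact ⟨e z, hz⟩
  -- a countable family of functionals separating the points of the closed span
  let Z : Submodule ℝ E := (Submodule.span ℝ (Set.range x)).topologicalClosure
  have hsep : TopologicalSpace.IsSeparable (Z : Set E) := by
    have : TopologicalSpace.IsSeparable (Submodule.span ℝ (Set.range x) : Set E) :=
      (Set.countable_range x).isSeparable.span
    simpa [Z, Submodule.topologicalClosure_coe] using this.closure
  obtain ⟨D, hD, hZD⟩ := hsep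
  -- Mazur: for the convex span, norm closure and weak closure agree.
  have hclosed : closure S ⊆ e '' (Z : Set E) := by
    have h1 : e '' closure (Submodule.span ℝ (Set.range x) : Set E)
        = closure (e '' (Submodule.span ℝ (Set.range x) : Set E)) :=
      (Submodule.span ℝ (Set.range x)).convex.toWeakSpace_closure (𝕜 := ℝ)
    rw [Submodule.topologicalClosure_coe, h1]
    refine closure_mono ?_
    rintro _ ⟨n, rfl⟩
    exact ⟨x n, Submodule.subset_span ⟨n, rfl⟩, rfl⟩
  have hmet : TopologicalSpace.MetrizableSpace (closure S) := by
    have hDne : D.Nonempty := by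
      by_contra h
      rw [Set.not_nonempty_iff_eq_empty] at h
      have := hZD Z.zero_mem
      simp [h] at this
    obtain ⟨z, hz⟩ := hD.exists_eq_range hDne
    -- Norming functionals of a dense sequence separate points: if v - v' is within half its norm of
    -- `z n`, then `f n` cannot vanish on it. A compact space with countably many separating
    -- continuous functions is metrizable.
    choose f hf1 hf2 using fun n => exists_dual_vector'' ℝ (z n)
    have hcs : CompactSpace (closure S) := isCompact_iff_compactSpace.1 hcpt
    refine Metric.PiNatEmbed.TopologicalSpace.MetrizableSpace.of_countable_separating
      (fun n (y : closure S) => f n (e.symm y.1)) (fun n => ?_) ?_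
    · exact (WeakBilin.eval_continuous (topDualPairing ℝ E).flip (f n)).comp continuous_subtype_val
    · rintro ⟨y, hy⟩ ⟨y', hy'⟩ hne
      obtain ⟨v, hv, rfl⟩ := hclosed hy
      obtain ⟨v', hv', rfl⟩ := hclosed hy'
      have hvv : v - v' ≠ 0 := fun h => hne (by simp [sub_eq_zero.1 h])
      have hpos := norm_pos_iff.2 hvv
      obtain ⟨_, ⟨n, rfl⟩, hn⟩ : ∃ b ∈ Set.range z, dist (v - v') b < ‖v - v'‖ / 2 := by
        rw [← hz]
        exact Metric.mem_closure_iff.1 (hZD (Z.sub_mem hv hv')) _ (by linarith)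
      refine ⟨n, fun h => ?_⟩
      have h0 : f n (v - v') = 0 := by
        rw [map_sub, sub_eq_zero]; exact h
      have h1 : ‖z n‖ ≤ ‖v - v' - z n‖ := by
        have h2 : ‖f n (v - v' - z n)‖ ≤ 1 * ‖v - v' - z n‖ :=
          ((f n).le_opNorm _).trans (by gcongr; exact hf1 n)
        rw [map_sub, h0, hf2, zero_sub, norm_neg, one_mul] at h2
        simpa using h2
      rw [dist_eq_norm] at hn
      have := norm_sub_norm_le (v - v') (z n)
      linarith
  have hseq : SeqCompactSpace (closure S) := by
    have hcs : CompactSpace (closure S) := isCompact_iff_compactSpace.1 hcpt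
    infer_instance
  obtain ⟨w, k, hk, hlim⟩ := SeqCompactSpace.tendsto_subseq
    (fun n => (⟨e (x n), subset_closure ⟨n, rfl⟩⟩ : closure S))
  refine ⟨e.symm w.1, k, hk, fun f => ?_⟩
  have hcont : Continuous fun y : closure S => f (e.symm y.1) :=
    (WeakBilin.eval_continuous (topDualPairing ℝ E).flip f).comp continuous_subtype_val
  exact (hcont.tendsto w).comp hlim

end WeakCompactness

/-! ### Reduction to X⁺ by minimization along the fibres -/

section Reduction

variable {H Y : Type*} [NormedAddCommGroup H] [InnerProductSpace ℝ H]
  [NormedAddCommGroup Y] [NormedSpace ℝ Y]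

/-- The embedding of `X⁺` into `X`. -/
def inlL : H →L[ℝ] Space H Y :=
  (WithLp.prodContinuousLinearEquiv 2 ℝ H Y).symm.toContinuousLinearMap.comp
    (ContinuousLinearMap.inl ℝ H Y)

/-- The embedding of `X̃` into `X`. -/
def inrL : Y →L[ℝ] Space H Y :=
  (WithLp.prodContinuousLinearEquiv 2 ℝ H Y).symm.toContinuousLinearMap.comp
    (ContinuousLinearMap.inr ℝ H Y)

@[simp] lemma inlL_apply (u : H) : (inlL u : Space H Y) = pair u 0 := rfl

@[simp] lemma inrL_apply (v : Y) : (inrL v : Space H Y) = pair 0 v := rfl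

lemma pair_add (u u' : H) (v v' : Y) : pair u v + pair u' v' = pair (u + u') (v + v') := rfl

lemma pair_neg (u : H) (v : Y) : -pair u v = pair (-u) (-v) := rfl

lemma pair_fst_snd (w : Space H Y) : pair w.fst w.snd = w := rfl

lemma norm_pair_zero (u : H) : ‖(pair u 0 : Space H Y)‖ = ‖u‖ :=
  WithLp.norm_toLp_fst 2 H Y u

lemma continuous_pair : Continuous fun p : H × Y => pair p.1 p.2 :=
  (WithLp.prodContinuousLinearEquiv 2 ℝ H Y).symm.continuous

lemma continuous_fst_space : Continuous fun w : Space H Y => w.fst :=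
  (WithLp.fstL 2 ℝ H Y).continuous

lemma continuous_snd_space : Continuous fun w : Space H Y => w.snd :=
  (WithLp.sndL 2 ℝ H Y).continuous

variable {I : Space H Y → ℝ} {r : ℝ}

lemma Conditions.contDiff_functional (hI : Conditions I r) : ContDiff ℝ 1 (functional I) := by
  have h : ContDiff ℝ 1 fun u : Space H Y => ‖WithLp.fstL 2 ℝ H Y u‖ ^ 2 / 2 :=
    ((WithLp.fstL 2 ℝ H Y).contDiff.norm_sq ℝ).div_const 2
  exact h.sub hI.i1_contDiff

lemma Conditions.differentiable (hI : Conditions I r) : Differentiable ℝ I :=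
  hI.i1_contDiff.differentiable one_ne_zero

lemma Conditions.fderiv_functional (hI : Conditions I r) (u w : Space H Y) :
    fderiv ℝ (functional I) u w = inner ℝ u.fst w.fst - fderiv ℝ I u w := by
  have h1 : HasFDerivAt (fun u : Space H Y => ‖u.fst‖ ^ 2) _ u :=
    ((WithLp.fstL 2 ℝ H Y).hasFDerivAt (x := u)).norm_sq
  have h2 := ((h1.mul_const (1 / 2 : ℝ)).sub (hI.differentiable u).hasFDerivAt)
  have h3 : functional I = fun u => ‖u.fst‖ ^ 2 * (1 / 2 : ℝ) - I u := by
    funext u; simp only [functional]; ring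
  have h4 := h2.fderiv
  rw [← Pi.sub_def] at h3
  rw [h3, h4]
  simp

lemma Conditions.mem_setM_iff (hI : Conditions I r) (u : Space H Y) :
    u ∈ setM I ↔ ∀ v : Y, fderiv ℝ I u (pair 0 v) = 0 := by
  simp only [setM, Set.mem_ofPred_eq, hI.fderiv_functional]
  refine forall_congr' fun v => ?_
  have : (pair (0 : H) v).fst = 0 := rfl
  rw [this, inner_zero_right, zero_sub, neg_eq_zero]

lemma Conditions.mem_setM_of_forall_le (hI : Conditions I r) {u : H} {v : Y}
    (h : ∀ v', I (pair u v) ≤ I (pair u v')) : pair u v ∈ setM I := by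
  rw [hI.mem_setM_iff]
  intro w
  have hd : HasFDerivAt (fun v' : Y => I (pair u 0 + inrL v'))
      ((fderiv ℝ I (pair u v)).comp inrL) v := by
    have h1 : HasFDerivAt (fun v' : Y => pair u 0 + inrL v') (inrL : Y →L[ℝ] Space H Y) v :=
      inrL.hasFDerivAt.const_add _
    have h2 : HasFDerivAt I (fderiv ℝ I (pair u v)) (pair u 0 + inrL v) := by
      have : pair u 0 + inrL v = pair u v := by simp [pair_add]
      rw [this]
      exact (hI.differentiable _).hasFDerivAt
    exact h2.comp v h1
  have hmin : IsLocalMin (fun v' : Y => I (pair u 0 + inrL v')) v :=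
    Eventually.of_forall fun v' => by simpa [pair_add] using h v'
  have := hmin.hasFDerivAt_eq_zero hd
  simpa using congrArg (fun L : Y →L[ℝ] ℝ => L w) this

/-- The form in which (I2) serves minimizing sequences, where upper bounds with a known limit are at
hand. -/
lemma Conditions.le_of_tendstoT (hI : Conditions I r) {x : ℕ → Space H Y} {w : Space H Y}
    (hx : TendstoT x w) {b : ℕ → ℝ} {L : ℝ} (hb : ∀ n, I (x n) ≤ b n)
    (hL : Tendsto b atTop (𝓝 L)) : I w ≤ L := by
  have h1 := hI.i2 x w hx
  have h2 : liminf (fun n => (I (x n) : EReal)) atTop ≤ liminf (fun n => (b n : EReal)) atTop :=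
    liminf_le_liminf (Eventually.of_forall fun n => EReal.coe_le_coe_iff.2 (hb n))
  have h3 : Tendsto (fun n => (b n : EReal)) atTop (𝓝 (L : EReal)) := EReal.tendsto_coe.2 hL
  rw [h3.liminf_eq] at h2
  exact EReal.coe_le_coe_iff.1 (h1.trans h2)

/-- The X⁺-parts converge and ℐ is bounded, so (I4) bounds the sequence and reflexivity gives the
weak limit of the X̃-parts. -/
lemma Conditions.exists_subseq_tendstoT (hI : Conditions I r) (hrefl : IsReflexive (Space H Y))
    {u : ℕ → H} {u₀ : H} (hu : Tendsto u atTop (𝓝 u₀)) {v : ℕ → Y} {C : ℝ}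
    (hC : ∀ n, I (pair (u n) (v n)) ≤ C) :
    ∃ (v₀ : Y) (k : ℕ → ℕ), StrictMono k ∧
      TendstoT (fun n => pair (u (k n)) (v (k n))) (pair u₀ v₀) := by
  obtain ⟨D, hD⟩ := hu.norm.bddAbove_range
  have hD' : ∀ n, ‖u n‖ ≤ D := fun n => hD ⟨n, rfl⟩
  obtain ⟨R, -, hR⟩ := hasBasis_cobounded_norm.eventually_iff.1 (hI.i4.eventually_gt_atTop (D + C))
  have hbd : ∀ n, ‖pair (u n) (v n)‖ ≤ R := by
    intro n
    by_contra h
    have h1 : D + C < ‖u n‖ + I (pair (u n) (v n)) := hR (not_le.1 h).le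
    linarith [hC n, hD' n]
  obtain ⟨w, k, hk, hw⟩ := hrefl.exists_weakly_convergent_subseq hbd
  refine ⟨w.snd, k, hk, hu.comp hk.tendsto_atTop, fun φ => ?_⟩
  exact hw (φ.comp (WithLp.sndL 2 ℝ H Y))

/-- The functional `ℐ` attains its minimum on every fibre `u + X̃`. -/
lemma Conditions.exists_forall_le (hI : Conditions I r) (hrefl : IsReflexive (Space H Y)) (u : H) :
    ∃ v : Y, ∀ v', I (pair u v) ≤ I (pair u v') := by
  set S : Set ℝ := Set.range fun v : Y => I (pair u v) with hS
  have hne : S.Nonempty := Set.range_nonempty _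
  have hbd : BddBelow S := ⟨0, by rintro _ ⟨v, rfl⟩; exact hI.i1_nonneg _⟩
  obtain ⟨b, -, hb, hbS⟩ := exists_seq_tendsto_sInf hne hbd
  choose v hv using hbS
  obtain ⟨C, hC⟩ := hb.bddAbove_range
  obtain ⟨v₀, k, hk, hT⟩ := hI.exists_subseq_tendstoT hrefl (u := fun _ => u)
    tendsto_const_nhds (v := v) (C := C) (fun n => (hv n).le.trans (hC ⟨n, rfl⟩))
  refine ⟨v₀, fun v' => ?_⟩
  have h1 : I (pair u v₀) ≤ sInf S :=
    hI.le_of_tendstoT hT (fun n => (hv (k n)).le) (hb.comp hk.tendsto_atTop)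
  exact h1.trans (csInf_le hbd ⟨v', rfl⟩)

/-- Applying (I5) at both points gives two opposite strict inequalities. -/
lemma Conditions.setM_snd_unique (hI : Conditions I r) {u : H} {v v' : Y}
    (h : pair u v ∈ setM I) (h' : pair u v' ∈ setM I) : v = v' := by
  by_contra hne
  have h1 := hI.i5 _ h (v' - v) (sub_ne_zero.2 (Ne.symm hne))
  have h2 := hI.i5 _ h' (v - v') (sub_ne_zero.2 hne)
  rw [pair_add, add_zero, add_sub_cancel] at h1 h2
  exact lt_asymm h1 h2

@[simp] lemma mapM_fst (I : Space H Y → ℝ) (u : H) : (mapM I u).fst = u := rfl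

section Map

variable (hI : Conditions I r) (hrefl : IsReflexive (Space H Y))

include hI hrefl

lemma Conditions.mapM_mem (u : H) : mapM I u ∈ setM I := by
  obtain ⟨v, hv⟩ := hI.exists_forall_le hrefl u
  exact Classical.epsilon_spec (p := fun v : Y => pair u v ∈ setM I)
    ⟨v, hI.mem_setM_of_forall_le hv⟩

lemma Conditions.mapM_eq {u : H} {v : Y} (h : pair u v ∈ setM I) : mapM I u = pair u v := by
  have := hI.setM_snd_unique (hI.mapM_mem hrefl u) h
  exact congrArg (pair u) this

lemma Conditions.mapM_fst_of_mem {w : Space H Y} (h : w ∈ setM I) : mapM I w.fst = w :=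
  hI.mapM_eq hrefl (v := w.snd) h

lemma Conditions.apply_mapM_le (u : H) (v : Y) : I (mapM I u) ≤ I (pair u v) := by
  obtain ⟨v₀, hv⟩ := hI.exists_forall_le hrefl u
  rw [hI.mapM_eq hrefl (hI.mem_setM_of_forall_le hv)]
  exact hv v

lemma Conditions.functional_le_reduced (u : H) (v : Y) :
    functional I (pair u v) ≤ reduced I u := by
  have := hI.apply_mapM_le hrefl u v
  change ‖u‖ ^ 2 / 2 - I (pair u v) ≤ ‖u‖ ^ 2 / 2 - I (mapM I u)
  linarith

/-- Comparing m(uₙ) with the X̃-part of m(u₀) bounds ℐ(m(uₙ)) by a sequence tending to ℐ(m(u₀)). A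
𝒯-limit is therefore again a minimizer, so it is m(u₀); the values of ℐ converge, and (I3) upgrades
to norm convergence. -/
lemma Conditions.continuous_mapM : Continuous (mapM I) := by
  rw [continuous_iff_seqContinuous]
  intro u u₀ hu
  refine tendsto_of_subseq_tendsto fun ns hns => ?_
  have hu' := hu.comp hns
  have hb : Tendsto (fun n => I (pair (u (ns n)) (mapM I u₀).snd)) atTop (𝓝 (I (mapM I u₀))) := by
    have hc : Continuous fun x : H => I (pair x (mapM I u₀).snd) :=
      hI.i1_contDiff.continuous.comp (continuous_pair.comp (continuous_id.prodMk continuous_const))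
    exact (hc.tendsto u₀).comp hu'
  have hle : ∀ n, I (mapM I (u (ns n))) ≤ I (pair (u (ns n)) (mapM I u₀).snd) := fun n =>
    hI.apply_mapM_le hrefl _ _
  obtain ⟨C, hC⟩ := hb.bddAbove_range
  obtain ⟨v₀, k, hk, hT⟩ := hI.exists_subseq_tendstoT hrefl hu'
    (v := fun n => (mapM I (u (ns n))).snd) (C := C) (fun n => (hle n).trans (hC ⟨n, rfl⟩))
  have hbk := hb.comp hk.tendsto_atTop
  have h1 : I (pair u₀ v₀) ≤ I (mapM I u₀) := hI.le_of_tendstoT hT (fun n => hle (k n)) hbk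
  have h2 : mapM I u₀ = pair u₀ v₀ :=
    hI.mapM_eq hrefl (hI.mem_setM_of_forall_le fun v' => h1.trans (hI.apply_mapM_le hrefl _ _))
  refine ⟨k, ?_⟩
  rw [h2]
  refine hI.i3 _ _ hT ?_
  refine tendsto_order.2 ⟨fun a ha => ?_, fun a ha => ?_⟩
  · have h3 := hI.i2 _ _ hT
    have h4 := eventually_lt_of_lt_liminf ((EReal.coe_lt_coe_iff.2 ha).trans_le h3)
    filter_upwards [h4] with n hn using EReal.coe_lt_coe_iff.1 hn
  · rw [← h2] at ha
    filter_upwards [(tendsto_order.1 hbk).2 a ha] with n hn using (hle (k n)).trans_lt hn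

/-- The reduced functional is differentiable, with the derivative of `𝒥` at `m(u)`. -/
lemma Conditions.hasFDerivAt_reduced (u : H) :
    HasFDerivAt (reduced I) ((fderiv ℝ (functional I) (mapM I u)).comp inlL) u := by
  have hstrict := (hI.contDiff_functional.contDiffAt (x := mapM I u)).hasStrictFDerivAt one_ne_zero
  have hm := hI.continuous_mapM hrefl
  rw [hasFDerivAt_iff_isLittleO, Asymptotics.isLittleO_iff]
  intro ε hε
  have hs := hstrict.isLittleO.def hε
  -- By maximality on fibres, the increment of 𝒥̃ lies between two increments of 𝒥 along u' - u, one
  -- with the X̃-part of m(u) and one with that of m(u'). Both take place near m(u), so strict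
  -- differentiability there controls them.
  have c1 : Tendsto (fun u' : H => (pair u' (mapM I u).snd, mapM I u)) (𝓝 u)
      (𝓝 (mapM I u, mapM I u)) := by
    have : Continuous fun u' : H => (pair u' (mapM I u).snd, mapM I u) :=
      (continuous_pair.comp (by fun_prop : Continuous fun u' : H => (u', (mapM I u).snd))).prodMk
        continuous_const
    exact this.tendsto u
  have c2 : Tendsto (fun u' : H => (mapM I u', pair u (mapM I u').snd)) (𝓝 u)
      (𝓝 (mapM I u, mapM I u)) := by
    have : Continuous fun u' : H => (mapM I u', pair u (mapM I u').snd) :=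
      hm.prodMk (continuous_pair.comp (continuous_const.prodMk (continuous_snd_space.comp hm)))
    exact this.tendsto u
  filter_upwards [c1.eventually hs, c2.eventually hs] with u' h1 h2
  have e1 : pair u' (mapM I u).snd - mapM I u = pair (u' - u) 0 :=
    congrArg (pair (u' - u)) (sub_self (mapM I u).snd)
  have e2 : mapM I u' - pair u (mapM I u').snd = pair (u' - u) 0 :=
    congrArg (pair (u' - u)) (sub_self (mapM I u').snd)
  rw [e1, norm_pair_zero] at h1
  rw [e2, norm_pair_zero] at h2
  have g1 := hI.functional_le_reduced hrefl u' (mapM I u).snd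
  have g2 := hI.functional_le_reduced hrefl u (mapM I u').snd
  have r1 : reduced I u = functional I (mapM I u) := rfl
  have r2 : reduced I u' = functional I (mapM I u') := rfl
  rw [Real.norm_eq_abs, abs_le] at h1 h2 ⊢
  rw [ContinuousLinearMap.comp_apply, inlL_apply]
  constructor <;> linarith [h1.1, h1.2, h2.1, h2.2]

lemma Conditions.fderiv_reduced (u : H) :
    fderiv ℝ (reduced I) u = (fderiv ℝ (functional I) (mapM I u)).comp inlL :=
  (hI.hasFDerivAt_reduced hrefl u).fderiv

lemma Conditions.differentiable_reduced : Differentiable ℝ (reduced I) := fun u =>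
  (hI.hasFDerivAt_reduced hrefl u).differentiableAt

lemma Conditions.continuous_fderiv_reduced : Continuous (fderiv ℝ (reduced I)) := by
  have h : fderiv ℝ (reduced I)
      = fun u => (fderiv ℝ (functional I) (mapM I u)).comp inlL :=
    funext (hI.fderiv_reduced hrefl)
  rw [h]
  exact ((hI.contDiff_functional.continuous_fderiv one_ne_zero).comp
    (hI.continuous_mapM hrefl)).clm_comp continuous_const

/-- On X̃ the derivative of 𝒥 at m(u) vanishes already, so only the X⁺ directions matter. -/
lemma Conditions.isCritical_mapM_iff (u : H) :
    IsCritical I (mapM I u) ↔ fderiv ℝ (reduced I) u = 0 := by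
  rw [hI.fderiv_reduced hrefl]
  constructor
  · intro h
    rw [IsCritical] at h
    rw [h, ContinuousLinearMap.zero_comp]
  · intro h
    ext w
    have h1 : fderiv ℝ (functional I) (mapM I u) (pair w.fst 0) = 0 :=
      congrArg (fun L : H →L[ℝ] ℝ => L w.fst) h
    have h2 : fderiv ℝ (functional I) (mapM I u) (pair 0 w.snd) = 0 := hI.mapM_mem hrefl u w.snd
    have h3 : w = pair w.fst 0 + pair 0 w.snd := by
      rw [pair_add, add_zero, zero_add, pair_fst_snd]
    rw [h3, map_add, h1, h2]
    simp

omit hrefl in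
lemma Conditions.mem_setM_of_isCritical {w : Space H Y} (h : IsCritical I w) : w ∈ setM I := by
  intro v
  rw [IsCritical] at h
  rw [h]; rfl

lemma Conditions.mapM_zero : mapM I 0 = 0 := by
  refine hI.mapM_eq hrefl (v := (0 : Y)) (hI.mem_setM_of_forall_le fun v' => ?_)
  have : pair (0 : H) (0 : Y) = 0 := rfl
  rw [this, hI.i1_zero]
  exact hI.i1_nonneg _

lemma Conditions.reduced_zero : reduced I 0 = 0 := by
  have h0 : (0 : Space H Y).fst = 0 := rfl
  rw [reduced, hI.mapM_zero hrefl, functional, hI.i1_zero, h0]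
  simp

lemma Conditions.exists_pos_le_reduced_of_norm_eq :
    ∃ a : ℝ, 0 < a ∧ ∀ u : H, ‖u‖ = r → a ≤ reduced I u := by
  obtain ⟨a, ha, h⟩ := hI.i6
  exact ⟨a, ha, fun u hu => (h u hu).trans (hI.functional_le_reduced hrefl u 0)⟩

/-- The reduced functional is negative far away on every compact family of rays. -/
lemma Conditions.exists_forall_reduced_smul_neg {Q : Set H} (hQ : IsCompact Q) (h0 : (0 : H) ∉ Q) :
    ∃ R : ℝ, ∀ t, R ≤ t → ∀ w ∈ Q, reduced I (t • w) < 0 := by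
  by_contra! hcon
  choose t ht w hw hJ using fun n : ℕ => hcon (n + 1 : ℝ)
  obtain ⟨w₀, hw₀, k, hk, hlim⟩ := hQ.tendsto_subseq hw
  have hne : w₀ ≠ 0 := fun h => h0 (h ▸ hw₀)
  have htpos : ∀ n, 0 < t n := fun n => lt_of_lt_of_le (by positivity) (ht n)
  have htop : Tendsto (fun n => t (k n)) atTop atTop := by
    have h1 : Tendsto t atTop atTop := by
      refine tendsto_atTop_mono ht ?_
      exact tendsto_atTop_add_const_right _ _ tendsto_natCast_atTop_atTop
    exact h1.comp hk.tendsto_atTop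
  -- (I7) is applied to m(t w)/t, whose X⁺-part is w; after division by t², ℐ beats the bounded term
  -- ‖w‖²/2.
  have h7 := hI.i7 (fun n => t (k n)) (fun n => (t (k n))⁻¹ • mapM I (t (k n) • w (k n))) w₀ htop
    (by
      refine hlim.congr fun n => ?_
      change w (k n) = (t (k n))⁻¹ • (t (k n) • w (k n))
      rw [smul_smul, inv_mul_cancel₀ (htpos _).ne', one_smul]) hne
  have hub := (hlim.norm.pow 2).div_const 2
  obtain ⟨n, h1, h2⟩ := ((h7.eventually_gt_atTop (‖w₀‖ ^ 2 / 2 + 1)).and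
    ((tendsto_order.1 hub).2 (‖w₀‖ ^ 2 / 2 + 1) (by linarith))).exists
  have h3 := hJ (k n)
  have h4 : reduced I (t (k n) • w (k n))
      = ‖t (k n) • w (k n)‖ ^ 2 / 2 - I (mapM I (t (k n) • w (k n))) := rfl
  have hsq : 0 < t (k n) ^ 2 := by have := htpos (k n); positivity
  rw [smul_smul, mul_inv_cancel₀ (htpos _).ne', one_smul, lt_div_iff₀ hsq] at h1
  rw [h4, norm_smul, Real.norm_of_nonneg (htpos _).le, mul_pow] at h3
  simp only [Function.comp_apply] at h2
  nlinarith

/-- Composition with m turns paths in X⁺ into paths in ℳ. The real infimum needs a lower bound, here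
0, because every path starts at energy 0. -/
lemma Conditions.levelM_le_of_path (σ : C(unitInterval, H)) (h0 : σ 0 = 0) (hr : r < ‖σ 1‖)
    (h1 : reduced I (σ 1) < 0) {b : ℝ} (hb : ∀ t, reduced I (σ t) ≤ b) : levelM I r ≤ b := by
  let γ : C(unitInterval, Space H Y) := ⟨fun t => mapM I (σ t), (hI.continuous_mapM hrefl).comp σ.2⟩
  have hγ : γ ∈ pathsM I r := by
    refine ⟨fun t => hI.mapM_mem hrefl _, ?_, hr, h1⟩
    change mapM I (σ 0) = 0
    rw [h0, hI.mapM_zero hrefl]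
  have hbdd : BddBelow (Set.range fun γ : pathsM I r =>
      ⨆ t : unitInterval, functional I (γ.1 t)) := by
    refine ⟨0, ?_⟩
    rintro _ ⟨γ, rfl⟩
    have hbd : BddAbove (Set.range fun t : unitInterval => functional I (γ.1 t)) :=
      (isCompact_range (hI.contDiff_functional.continuous.comp γ.1.2)).bddAbove
    refine le_ciSup_of_le hbd 0 (le_of_eq ?_)
    have e : γ.1 0 = 0 := γ.2.2.1
    have h0 : (0 : Space H Y).fst = 0 := rfl
    rw [e, functional, hI.i1_zero, h0]
    simp
  exact (ciInf_le hbdd ⟨γ, hγ⟩).trans (ciSup_le hb)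

omit hrefl in
lemma Conditions.functional_le_iSup (γ : C(unitInterval, Space H Y)) (t : unitInterval) :
    functional I (γ t) ≤ ⨆ t : unitInterval, functional I (γ t) :=
  le_ciSup (f := fun t : unitInterval => functional I (γ t))
    (isCompact_range (hI.contDiff_functional.continuous.comp γ.2)).bddAbove t

lemma Conditions.nonempty_pathsM [Nontrivial H] : Nonempty (pathsM I r) := by
  obtain ⟨w, hw⟩ := exists_ne (0 : H)
  obtain ⟨R, hR⟩ := hI.exists_forall_reduced_smul_neg hrefl (Q := {w}) isCompact_singleton
    (by simpa using hw.symm)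
  set T := max R ((r + 1) / ‖w‖) with hT
  have hwn : 0 < ‖w‖ := norm_pos_iff.2 hw
  have hr := hI.i6_pos
  refine ⟨⟨⟨fun t => mapM I ((t : ℝ) • T • w), (hI.continuous_mapM hrefl).comp (by fun_prop)⟩,
    fun t => hI.mapM_mem hrefl _, ?_, ?_, ?_⟩⟩
  · simp [hI.mapM_zero hrefl]
  · simp only [ContinuousMap.coe_mk, mapM_fst, Set.Icc.coe_one, one_smul, norm_smul]
    have h1 : (r + 1) / ‖w‖ ≤ T := le_max_right _ _
    rw [div_le_iff₀ hwn] at h1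
    have : T * ‖w‖ ≤ ‖T‖ * ‖w‖ := by gcongr; exact le_abs_self T
    linarith
  · simpa [reduced] using hR T (le_max_left _ _) w rfl

/-- Every admissible path has a point with ‖u⁺‖ = r, where (I6) bounds the energy from below. -/
lemma Conditions.levelM_pos [Nontrivial H] : 0 < levelM I r := by
  obtain ⟨a, ha, hle⟩ := hI.exists_pos_le_reduced_of_norm_eq hrefl
  have := hI.nonempty_pathsM hrefl
  refine ha.trans_le (le_ciInf fun γ => ?_)
  obtain ⟨hM, h0, h1, -⟩ := γ.2
  have hc : Continuous fun t => ‖(γ.1 t).fst‖ := (continuous_fst_space.comp γ.1.2).norm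
  have hivt : r ∈ Set.range fun t => ‖(γ.1 t).fst‖ := by
    refine mem_range_of_exists_le_of_exists_ge hc ⟨0, ?_⟩ ⟨1, h1.le⟩
    rw [h0]
    have e : (0 : Space H Y).fst = 0 := rfl
    rw [e, norm_zero]
    exact hI.i6_pos.le
  obtain ⟨t, ht⟩ := hivt
  refine (hle _ ht).trans ?_
  rw [reduced, hI.mapM_fst_of_mem hrefl (hM t)]
  exact hI.functional_le_iSup γ.1 t

/-- By (I8) every nontrivial critical point has energy at least `c_ℳ`. -/
lemma Conditions.levelM_le_of_isCritical {w : Space H Y} (hw : IsCritical I w) (hne : w ≠ 0) :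
    levelM I r ≤ functional I w := by
  have hm := hI.mapM_fst_of_mem hrefl (hI.mem_setM_of_isCritical hw)
  have hfst : w.fst ≠ 0 := by
    intro h
    rw [h, hI.mapM_zero hrefl] at hm
    exact hne hm.symm
  have hcrit : fderiv ℝ (functional I) w = 0 := hw
  have hN : w ∈ setN I := ⟨hfst, fun s v => by rw [hcrit]; rfl⟩
  have d0 : ∀ x, fderiv ℝ I w x = inner ℝ w.fst x.fst := by
    intro x
    have := hI.fderiv_functional w x
    rw [hcrit] at this
    have h0 : (0 : Space H Y →L[ℝ] ℝ) x = 0 := rfl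
    linarith
  -- At a critical point ℐ'(w) = ⟨w⁺, ·⟩, so (I8) reads 𝒥(tw + v) ≤ 𝒥(w). The choice of v makes tw +
  -- v = m(t w⁺), and the ray through w⁺ becomes an admissible path with maximum at most 𝒥(w).
  have key : ∀ t : ℝ, 0 ≤ t → reduced I (t • w.fst) ≤ functional I w := by
    intro t ht
    set v := (mapM I (t • w.fst)).snd - t • w.snd with hv
    have h8 := hI.i8 w hN t ht v
    have e : t • w + pair 0 v = mapM I (t • w.fst) := by
      have e1 : t • w = pair (t • w.fst) (t • w.snd) := rfl
      rw [e1, pair_add, add_zero, hv, add_sub_cancel]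
      rfl
    have e2 : (pair (0 : H) v).fst = 0 := rfl
    rw [e, d0, d0, e2, inner_zero_right, real_inner_self_eq_norm_sq] at h8
    change ‖t • w.fst‖ ^ 2 / 2 - I (mapM I (t • w.fst)) ≤ ‖w.fst‖ ^ 2 / 2 - I w
    rw [norm_smul, mul_pow, Real.norm_eq_abs, sq_abs]
    linarith
  obtain ⟨R, hR⟩ := hI.exists_forall_reduced_smul_neg hrefl (Q := {w.fst}) isCompact_singleton
    (by simpa using hfst.symm)
  set T := max (max R 0) ((r + 1) / ‖w.fst‖) with hT
  have hT0 : 0 ≤ T := (le_max_right R 0).trans (le_max_left _ _)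
  have hwn : 0 < ‖w.fst‖ := norm_pos_iff.2 hfst
  refine hI.levelM_le_of_path hrefl ⟨fun t => ((t : ℝ) * T) • w.fst, by fun_prop⟩ (by simp) ?_ ?_
    fun t => key _ (mul_nonneg t.2.1 hT0)
  · simp only [ContinuousMap.coe_mk, Set.Icc.coe_one, one_mul, norm_smul, Real.norm_of_nonneg hT0]
    have h1 : (r + 1) / ‖w.fst‖ ≤ T := le_max_right _ _
    rw [div_le_iff₀ hwn] at h1
    linarith
  · simpa using hR T ((le_max_left R 0).trans (le_max_left _ _)) w.fst rfl

lemma Conditions.mapM_neg (heven : ∀ u, functional I (-u) = functional I u) (u : H) :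
    mapM I (-u) = -mapM I u := by
  have hIe : ∀ u, I (-u) = I u := by
    intro u
    have h := heven u
    have h2 : (-u).fst = -u.fst := rfl
    simp only [functional, h2, norm_neg] at h
    linarith
  refine hI.mapM_eq hrefl (v := -(mapM I u).snd) (hI.mem_setM_of_forall_le fun v' => ?_)
  have h1 := hI.apply_mapM_le hrefl u (-v')
  rw [← hIe, ← hIe (pair u (-v'))] at h1
  have e : -pair u (-v') = pair (-u) v' := by rw [pair_neg, neg_neg]
  rw [e] at h1
  exact h1

lemma Conditions.reduced_neg (heven : ∀ u, functional I (-u) = functional I u) (u : H) :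
    reduced I (-u) = reduced I u := by
  rw [reduced, hI.mapM_neg hrefl heven, heven, reduced]

end Map

end Reduction

/-! ### Discrete descent for C¹ functionals -/

section Descent

variable {H : Type*} [NormedAddCommGroup H] [InnerProductSpace ℝ H] [CompleteSpace H]

/-- The weighted slope `(1 + ‖u‖) ‖Φ'(u)‖` of the Cerami condition. -/
def weightedSlope (Φ : H → ℝ) (u : H) : ℝ := (1 + ‖u‖) * ‖fderiv ℝ Φ u‖

lemma weightedSlope_nonneg (Φ : H → ℝ) (u : H) : 0 ≤ weightedSlope Φ u := by
  unfold weightedSlope; positivity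

lemma weightedSlope_eq_zero_iff {Φ : H → ℝ} {u : H} :
    weightedSlope Φ u = 0 ↔ fderiv ℝ Φ u = 0 := by
  have : 1 + ‖u‖ ≠ 0 := by positivity
  simp [weightedSlope, this]

lemma continuous_weightedSlope {Φ : H → ℝ} (hc : Continuous (fderiv ℝ Φ)) :
    Continuous (weightedSlope Φ) := by
  unfold weightedSlope; fun_prop

/-- One step of a descent method for `Φ` with variable step size `σ`, localized by `ψ`. -/
structure IsDescentStep (Φ ψ : H → ℝ) (s : ℝ) (F : H → H) (σ : H → ℝ) : Prop where
  continuous : Continuous F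
  continuous_size : Continuous σ
  size_pos : ∀ u, 0 < σ u
  size_le : ∀ u, σ u ≤ s
  norm_sub_le : ∀ u, ‖F u - u‖ ≤ σ u * ψ u * (1 + ‖u‖)
  decrease : ∀ u, Φ (F u) ≤ Φ u - σ u * ψ u * weightedSlope Φ u / 2

/-- The normalized descent direction. -/
def descentField (Φ ψ : H → ℝ) (u : H) : H :=
  -((ψ u * (1 + ‖u‖) / ‖fderiv ℝ Φ u‖) • gradient Φ u)

lemma norm_gradient (Φ : H → ℝ) (u : H) : ‖gradient Φ u‖ = ‖fderiv ℝ Φ u‖ := by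
  simp [gradient]

lemma fderiv_apply_gradient (Φ : H → ℝ) (u : H) :
    fderiv ℝ Φ u (gradient Φ u) = ‖fderiv ℝ Φ u‖ ^ 2 := by
  have h : fderiv ℝ Φ u = InnerProductSpace.toDual ℝ H (gradient Φ u) := by simp [gradient]
  conv_lhs => rw [h]
  rw [InnerProductSpace.toDual_apply_apply, real_inner_self_eq_norm_sq, norm_gradient]

lemma norm_descentField_le {Φ ψ : H → ℝ} (hψ : ∀ u, 0 ≤ ψ u) (u : H) :
    ‖descentField Φ ψ u‖ ≤ ψ u * (1 + ‖u‖) := by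
  have h0 : 0 ≤ ψ u * (1 + ‖u‖) := mul_nonneg (hψ u) (by positivity)
  rw [descentField, norm_neg, norm_smul, norm_gradient, norm_div, norm_norm, Real.norm_of_nonneg h0]
  rcases eq_or_ne ‖fderiv ℝ Φ u‖ 0 with h | h
  · simpa [h] using h0
  · rw [div_mul_cancel₀ _ h]

lemma fderiv_apply_descentField (Φ ψ : H → ℝ) (u : H) :
    fderiv ℝ Φ u (descentField Φ ψ u) = -(ψ u * weightedSlope Φ u) := by
  rw [descentField, map_neg, map_smul, fderiv_apply_gradient, weightedSlope, smul_eq_mul]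
  rcases eq_or_ne ‖fderiv ℝ Φ u‖ 0 with h | h
  · simp [h]
  · field_simp

lemma descentField_eq_zero {Φ ψ : H → ℝ} {u : H} (h : ψ u = 0) : descentField Φ ψ u = 0 := by
  simp [descentField, h]

/-- The normalization is singular only at critical points, which the support of ψ avoids. -/
lemma continuous_descentField {Φ ψ : H → ℝ} (hc : Continuous (fderiv ℝ Φ)) (hψ : Continuous ψ)
    (hcrit : ∀ u ∈ tsupport ψ, fderiv ℝ Φ u ≠ 0) : Continuous (descentField Φ ψ) := by
  refine continuous_of_tsupport fun u hu => ?_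
  have hu' : u ∈ tsupport ψ := by
    refine closure_mono ?_ hu
    intro v hv hψv
    exact hv (descentField_eq_zero hψv)
  have h1 : Continuous (gradient Φ) := (InnerProductSpace.toDual ℝ H).symm.continuous.comp hc
  unfold descentField
  refine (ContinuousAt.smul ?_ h1.continuousAt).neg
  exact ContinuousAt.div (by fun_prop) (by fun_prop) (norm_ne_zero_iff.2 (hcrit u hu'))

/-- The steps of size at most `c` along the descent field decrease `Φ` at half the full rate. -/
lemma exists_local_step_size {Φ ψ : H → ℝ} (hd : Differentiable ℝ Φ)
    (hc : Continuous (fderiv ℝ Φ)) (hψ0 : ∀ u, 0 ≤ ψ u) (hψ1 : ∀ u, ψ u ≤ 1)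
    (hcrit : ∀ u ∈ tsupport ψ, fderiv ℝ Φ u ≠ 0) (u₀ : H) :
    ∃ c : ℝ, 0 < c ∧ ∀ᶠ u in 𝓝 u₀, ∀ t, 0 < t → t ≤ c →
      Φ (u + t • descentField Φ ψ u) ≤ Φ u - t * ψ u * weightedSlope Φ u / 2 := by
  by_cases hu₀ : u₀ ∈ tsupport ψ
  · have hg : 0 < ‖fderiv ℝ Φ u₀‖ := norm_pos_iff.2 (hcrit u₀ hu₀)
    set g := ‖fderiv ℝ Φ u₀‖ with hgdef
    obtain ⟨ε, hε, hball⟩ := Metric.continuousAt_iff.1 (hc.continuousAt (x := u₀)) (g / 8)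
      (by positivity)
    -- The field has norm at most K/2 near `u₀`, so steps of size at most ε/K move by at most ε/2
    -- and stay in the ball where Φ' is within g/8 of Φ'(u₀). There Φ' differs from Φ'(u) by at most
    -- g/4 ≤ ‖Φ'(u)‖/2, hence half the first-order decrease survives.
    set K := 2 * (2 + ‖u₀‖ + ε) with hK
    have hKpos : 0 < K := by positivity
    refine ⟨ε / K, by positivity, ?_⟩
    filter_upwards [Metric.ball_mem_nhds u₀ (half_pos hε)] with u hu t ht htc
    have hV := norm_descentField_le (Φ := Φ) hψ0 u
    set V := descentField Φ ψ u with hVdef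
    have hudist : ‖u - u₀‖ < ε / 2 := by simpa [dist_eq_norm] using hu
    have hun : ‖u‖ ≤ ‖u₀‖ + ε := by
      have := norm_sub_norm_le u u₀
      linarith
    have hVK : ‖V‖ ≤ K / 2 := by
      refine hV.trans ?_
      have := norm_nonneg u
      nlinarith [hψ1 u, hψ0 u]
    have hstep : ‖t • V‖ ≤ ε / 2 := by
      rw [norm_smul, Real.norm_of_nonneg ht.le]
      calc t * ‖V‖ ≤ ε / K * (K / 2) := by gcongr
        _ = ε / 2 := by field_simp
    have hfd : ∀ v ∈ Metric.ball u₀ ε, ‖fderiv ℝ Φ v - fderiv ℝ Φ u₀‖ ≤ g / 8 := fun v hv => by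
      have := hball hv
      rw [dist_eq_norm] at this
      exact this.le
    have hu1 : u ∈ Metric.ball u₀ ε := by
      rw [Metric.mem_ball, dist_eq_norm]; linarith
    have hu2 : u + t • V ∈ Metric.ball u₀ ε := by
      rw [Metric.mem_ball, dist_eq_norm]
      have : u + t • V - u₀ = (u - u₀) + t • V := by abel
      rw [this]
      exact (norm_add_le _ _).trans_lt (by linarith)
    have hfu := hfd u hu1
    have hgu : 7 * g / 8 ≤ ‖fderiv ℝ Φ u‖ := by
      have := norm_sub_norm_le (fderiv ℝ Φ u₀) (fderiv ℝ Φ u)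
      rw [norm_sub_rev] at this
      linarith
    have hmv := (convex_ball u₀ ε).norm_image_sub_le_of_norm_fderiv_le' (𝕜 := ℝ) (f := Φ)
      (φ := fderiv ℝ Φ u) (C := ‖fderiv ℝ Φ u‖ / 2) (fun v _ => hd v) (fun v hv => ?_) hu1 hu2
    · rw [add_sub_cancel_left, map_smul, fderiv_apply_descentField, norm_smul,
        Real.norm_of_nonneg ht.le, Real.norm_eq_abs, smul_eq_mul] at hmv
      have h1 := (abs_le.1 hmv).2
      have h2 : ‖fderiv ℝ Φ u‖ / 2 * (t * ‖V‖) ≤ t * ψ u * weightedSlope Φ u / 2 := by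
        calc ‖fderiv ℝ Φ u‖ / 2 * (t * ‖V‖) ≤ ‖fderiv ℝ Φ u‖ / 2 * (t * (ψ u * (1 + ‖u‖))) := by
              gcongr
          _ = t * ψ u * weightedSlope Φ u / 2 := by rw [weightedSlope]; ring
      linarith
    · have h1 := hfd v hv
      have h2 : fderiv ℝ Φ v - fderiv ℝ Φ u
          = (fderiv ℝ Φ v - fderiv ℝ Φ u₀) - (fderiv ℝ Φ u - fderiv ℝ Φ u₀) := by abel
      rw [h2]
      exact (norm_sub_le _ _).trans (by linarith)
  · refine ⟨1, one_pos, ?_⟩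
    filter_upwards [(isClosed_tsupport ψ).isOpen_compl.mem_nhds hu₀] with u hu t _ _
    have : ψ u = 0 := image_eq_zero_of_notMem_tsupport hu
    simp [descentField_eq_zero this, this]

lemma fderiv_neg_of_even {Φ : H → ℝ} (hd : Differentiable ℝ Φ) (heven : ∀ u, Φ (-u) = Φ u)
    (u : H) : fderiv ℝ Φ (-u) = -fderiv ℝ Φ u := by
  have h1 : HasFDerivAt (fun x => Φ (-x)) ((fderiv ℝ Φ (-u)).comp (-ContinuousLinearMap.id ℝ H)) u :=
    (hd (-u)).hasFDerivAt.comp u (hasFDerivAt_id u).neg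
  rw [funext heven] at h1
  rw [h1.fderiv]
  ext v
  simp

/-- The admissible step sizes at a point form an interval with left end 0, a convex condition, so
locally constant choices glue to a continuous one. -/
lemma exists_isDescentStep {Φ ψ : H → ℝ} (hd : Differentiable ℝ Φ)
    (hc : Continuous (fderiv ℝ Φ)) (hψ : Continuous ψ) (hψ0 : ∀ u, 0 ≤ ψ u) (hψ1 : ∀ u, ψ u ≤ 1)
    (hcrit : ∀ u ∈ tsupport ψ, fderiv ℝ Φ u ≠ 0) {s : ℝ} (hs : 0 < s) :
    ∃ (F : H → H) (σ : H → ℝ), IsDescentStep Φ ψ s F σ ∧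
      ((∀ u, Φ (-u) = Φ u) → (∀ u, ψ (-u) = ψ u) → ∀ u, F (-u) = -F u) := by
  obtain ⟨τ, hτ⟩ := exists_continuous_forall_mem_convex_of_local_const (E := ℝ) (X := H)
    (t := fun u => {c | (0 < c ∧ c ≤ s) ∧ ∀ t, 0 < t → t ≤ c →
      Φ (u + t • descentField Φ ψ u) ≤ Φ u - t * ψ u * weightedSlope Φ u / 2})
    (fun u => by
      refine Set.OrdConnected.convex ⟨fun a ha b hb c hcab => ?_⟩
      exact ⟨⟨ha.1.1.trans_le hcab.1, hcab.2.trans hb.1.2⟩,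
        fun t ht htc => hb.2 t ht (htc.trans hcab.2)⟩)
    (fun u => by
      obtain ⟨c, hc0, h⟩ := exists_local_step_size hd hc hψ0 hψ1 hcrit u
      refine ⟨min c s, ?_⟩
      filter_upwards [h] with v hv
      exact ⟨⟨lt_min hc0 hs, min_le_right _ _⟩,
        fun t ht htc => hv t ht (htc.trans (min_le_left _ _))⟩)
  -- Shrinking the step keeps it admissible; the minimum makes it even, hence the map odd when Φ and
  -- ψ are even.
  refine ⟨fun u => u + min (τ u) (τ (-u)) • descentField Φ ψ u, fun u => min (τ u) (τ (-u)),
    ⟨?_, ?_, ?_, ?_, ?_, ?_⟩, ?_⟩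
  · have := continuous_descentField hc hψ hcrit
    fun_prop
  · fun_prop
  · exact fun u => lt_min (hτ u).1.1 (hτ (-u)).1.1
  · exact fun u => (min_le_left _ _).trans (hτ u).1.2
  · intro u
    have h0 : 0 < min (τ u) (τ (-u)) := lt_min (hτ u).1.1 (hτ (-u)).1.1
    rw [add_sub_cancel_left, norm_smul, Real.norm_of_nonneg h0.le, mul_assoc]
    exact mul_le_mul_of_nonneg_left (norm_descentField_le hψ0 u) h0.le
  · exact fun u => (hτ u).2 _ (lt_min (hτ u).1.1 (hτ (-u)).1.1) (min_le_left _ _)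
  · intro heven hψe u
    have h1 : gradient Φ (-u) = -gradient Φ u := by
      simp [gradient, fderiv_neg_of_even hd heven]
    have h2 : descentField Φ ψ (-u) = -descentField Φ ψ u := by
      rw [descentField, descentField, h1, fderiv_neg_of_even hd heven, hψe, norm_neg, norm_neg,
        smul_neg]
    simp only [neg_neg]
    rw [h2, min_comm, smul_neg, neg_add]

/-- A descending sequence which crosses an annulus where the slope is large loses energy. -/
lemma energy_le_of_crossing {u : ℕ → H} {φ s : ℕ → ℝ} {z : H} {ρ R L δ s₀ : ℝ} (hδ : 0 ≤ δ)
    (hs : ∀ n, 0 ≤ s n) (hs₀ : ∀ n, s n ≤ s₀) (hL : 1 + ‖z‖ + R ≤ L) (hLpos : 0 < L)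
    (hstep : ∀ n, ‖u (n + 1) - u n‖ ≤ s n * (1 + ‖u n‖)) (hmono : ∀ n, φ (n + 1) ≤ φ n)
    {i j : ℕ} (hij : i ≤ j)
    (hdec : ∀ k, i ≤ k → k < j → ρ ≤ ‖u k - z‖ → ‖u k - z‖ < R → φ (k + 1) ≤ φ k - s k * δ / 2)
    (hi : ‖u i - z‖ < ρ) (hj : R ≤ ‖u j - z‖) :
    δ * (R - ρ - s₀ * L) / (2 * L) ≤ φ i - φ j := by
  classical
  have hex : ∃ k, i ≤ k ∧ R ≤ ‖u k - z‖ := ⟨j, hij, hj⟩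
  set k₁ := Nat.find hex with hk₁
  obtain ⟨hik₁, hRk₁⟩ := Nat.find_spec hex
  have hk₁j : k₁ ≤ j := Nat.find_min' hex ⟨hij, hj⟩
  have hs₀0 : 0 ≤ s₀ := (hs 0).trans (hs₀ 0)
  have hanti : Antitone φ := antitone_nat_of_succ_le hmono
  -- Up to the first exit time `k₁`, a step from inside radius ρ overshoots by at most `s₀ * L`. A
  -- step in the annulus moves by at most `s k * L` and costs energy `s k * δ / 2`.
  have key : ∀ k, i ≤ k → k ≤ k₁ →
      δ * ‖u k - z‖ ≤ δ * (ρ + s₀ * L) + 2 * L * (φ i - φ k) := by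
    intro k hik
    induction k, hik using Nat.le_induction with
    | base =>
      intro _
      have h1 : δ * ‖u i - z‖ ≤ δ * ρ := by gcongr
      have h2 : 0 ≤ δ * (s₀ * L) := by positivity
      linarith
    | succ k hik ih =>
      intro hk
      have hlt : k < k₁ := hk
      have hR : ‖u k - z‖ < R := by
        by_contra h
        exact Nat.find_min hex hlt ⟨hik, not_lt.1 h⟩
      have hnorm : 1 + ‖u k‖ ≤ L := by
        have := norm_sub_norm_le (u k) z
        linarith
      have hstepk : ‖u (k + 1) - u k‖ ≤ s k * L :=
        (hstep k).trans (mul_le_mul_of_nonneg_left hnorm (hs k))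
      have htri : ‖u (k + 1) - z‖ ≤ ‖u k - z‖ + s k * L := by
        have : u (k + 1) - z = (u k - z) + (u (k + 1) - u k) := by abel
        rw [this]
        exact (norm_add_le _ _).trans (by linarith)
      rcases lt_or_ge ‖u k - z‖ ρ with h | h
      · have h1 : φ (k + 1) ≤ φ i := hanti (hik.trans (Nat.le_succ k))
        have h2 : s k * L ≤ s₀ * L := by gcongr; exact hs₀ k
        have h3 : δ * ‖u (k + 1) - z‖ ≤ δ * (ρ + s₀ * L) := by gcongr; linarith
        have h4 : 0 ≤ 2 * L * (φ i - φ (k + 1)) := mul_nonneg (by linarith) (by linarith)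
        linarith
      · have h1 := ih hlt.le
        have h2 := hdec k hik (hlt.trans_le hk₁j) h hR
        have h3 : δ * ‖u (k + 1) - z‖ ≤ δ * (‖u k - z‖ + s k * L) := by gcongr
        have h4 : L * (φ (k + 1)) ≤ L * (φ k - s k * δ / 2) := by gcongr
        linarith
  have h1 := key k₁ hik₁ le_rfl
  have h2 : δ * R ≤ δ * ‖u k₁ - z‖ := by gcongr
  have h3 : φ j ≤ φ k₁ := hanti hk₁j
  have h4 : L * φ j ≤ L * φ k₁ := by gcongr
  rw [div_le_iff₀ (by linarith)]
  linarith

/-- Almost critical points between the levels `0` and `β` are bounded and, at a distance less than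
`m` from each other, are close to each other. -/
structure HasDiscreteAlmostCritical (Φ : H → ℝ) (β m M : ℝ) : Prop where
  pos : 0 < m
  nonneg : 0 ≤ M
  bounded : ∃ δ : ℝ, 0 < δ ∧ ∀ u, 0 ≤ Φ u → Φ u ≤ β → weightedSlope Φ u < δ → ‖u‖ ≤ M
  gap : ∀ ρ : ℝ, 0 < ρ → ∃ δ : ℝ, 0 < δ ∧ ∀ u v, 0 ≤ Φ u → Φ u ≤ β → 0 ≤ Φ v → Φ v ≤ β →
    weightedSlope Φ u < δ → weightedSlope Φ v < δ → ‖u - v‖ < m → ‖u - v‖ < ρ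

variable {Φ ψ : H → ℝ} {F : H → H} {σ : H → ℝ} {s β m M : ℝ}

lemma IsDescentStep.iterate_antitone (hF : IsDescentStep Φ ψ s F σ) (hψ0 : ∀ u, 0 ≤ ψ u) (x : H) :
    Antitone fun n => Φ (F^[n] x) := by
  refine antitone_nat_of_succ_le fun n => ?_
  rw [Function.iterate_succ_apply']
  have h1 := hF.decrease (F^[n] x)
  have h2 : 0 ≤ σ (F^[n] x) * ψ (F^[n] x) * weightedSlope Φ (F^[n] x) :=
    mul_nonneg (mul_nonneg (hF.size_pos _).le (hψ0 _)) (weightedSlope_nonneg _ _)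
  linarith

/-- With summable steps a discrete Gronwall bound keeps the trajectory bounded, so it converges. By
continuity the step sizes tend to the positive size at the limit, contradicting summability. -/
lemma IsDescentStep.not_summable_size (hF : IsDescentStep Φ ψ s F σ) (hψ1 : ∀ u, ψ u ≤ 1) (x : H) :
    ¬ Summable fun n => σ (F^[n] x) := by
  intro hsum
  set u : ℕ → H := fun n => F^[n] x with hu
  have hstep : ∀ n, ‖u (n + 1) - u n‖ ≤ σ (u n) * (1 + ‖u n‖) := by
    intro n
    have h1 : u (n + 1) = F (u n) := Function.iterate_succ_apply' F n x
    rw [h1]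
    refine (hF.norm_sub_le _).trans ?_
    have h2 := hF.size_pos (u n)
    have h3 : σ (u n) * ψ (u n) ≤ σ (u n) := mul_le_of_le_one_right h2.le (hψ1 _)
    gcongr
  have hbd : ∀ n, 1 + ‖u n‖ ≤ Real.exp (∑ k ∈ Finset.range n, σ (u k)) * (1 + ‖u 0‖) := by
    intro n
    induction n with
    | zero => simp
    | succ n ih =>
      have h1 : ‖u (n + 1)‖ ≤ ‖u n‖ + σ (u n) * (1 + ‖u n‖) := by
        have := norm_sub_norm_le (u (n + 1)) (u n)
        linarith [hstep n]
      have h2 : σ (u n) + 1 ≤ Real.exp (σ (u n)) := Real.add_one_le_exp _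
      rw [Finset.sum_range_succ, Real.exp_add]
      have h3 : (0 : ℝ) ≤ 1 + ‖u n‖ := by positivity
      calc 1 + ‖u (n + 1)‖ ≤ (σ (u n) + 1) * (1 + ‖u n‖) := by linarith
        _ ≤ Real.exp (σ (u n)) * (1 + ‖u n‖) := by gcongr
        _ ≤ Real.exp (σ (u n)) * (Real.exp (∑ k ∈ Finset.range n, σ (u k)) * (1 + ‖u 0‖)) := by
          gcongr
        _ = _ := by ring
  set C := Real.exp (∑' k, σ (u k)) * (1 + ‖u 0‖) with hC
  have hbd' : ∀ n, 1 + ‖u n‖ ≤ C := by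
    intro n
    refine (hbd n).trans ?_
    have := hsum.sum_le_tsum (Finset.range n) (fun k _ => (hF.size_pos (u k)).le)
    exact mul_le_mul_of_nonneg_right (Real.exp_le_exp.2 this) (by positivity)
  have hcauchy : CauchySeq u := by
    refine cauchySeq_of_dist_le_of_summable (fun n => σ (u n) * C) (fun n => ?_)
      (hsum.mul_right C)
    rw [dist_comm, dist_eq_norm]
    exact (hstep n).trans (mul_le_mul_of_nonneg_left (hbd' n) (hF.size_pos _).le)
  obtain ⟨w, hw⟩ := cauchySeq_tendsto_of_complete hcauchy
  have h1 : Tendsto (fun n => σ (u n)) atTop (𝓝 (σ w)) := (hF.continuous_size.tendsto w).comp hw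
  have h2 := tendsto_nhds_unique h1 hsum.tendsto_atTop_zero
  exact (hF.size_pos w).ne' h2

/-- A trajectory which stays between the levels `0` and `β`, where the descent is not cut off,
accumulates at a critical point. -/
lemma IsDescentStep.exists_critical_mem_closure (hF : IsDescentStep Φ ψ s F σ)
    (hψ0 : ∀ u, 0 ≤ ψ u) (hψ1 : ∀ u, ψ u ≤ 1) (hc : Continuous (fderiv ℝ Φ))
    (hgap : HasDiscreteAlmostCritical Φ β m M) (hs : s * (1 + M + m) ≤ m / 4) {x : H}
    (h0 : ∀ n, 0 ≤ Φ (F^[n] x)) (hβ : ∀ n, Φ (F^[n] x) ≤ β) (hone : ∀ n, ψ (F^[n] x) = 1) :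
    ∃ w ∈ closure (Set.range fun n => F^[n] x), fderiv ℝ Φ w = 0 := by
  set u : ℕ → H := fun n => F^[n] x with hu
  have hsucc : ∀ n, u (n + 1) = F (u n) := fun n => Function.iterate_succ_apply' F n x
  have hmono : Antitone fun n => Φ (u n) := hF.iterate_antitone hψ0 x
  have hdec : ∀ n, Φ (u (n + 1)) ≤ Φ (u n) - σ (u n) * weightedSlope Φ (u n) / 2 := by
    intro n
    have h1 := hF.decrease (u n)
    have h2 : ψ (u n) = 1 := hone n
    rwa [← hsucc, h2, mul_one] at h1
  have hstep : ∀ n, ‖u (n + 1) - u n‖ ≤ σ (u n) * (1 + ‖u n‖) := by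
    intro n
    have h1 := hF.norm_sub_le (u n)
    have h2 : ψ (u n) = 1 := hone n
    rwa [← hsucc, h2, mul_one] at h1
  have hsum : Summable fun n => σ (u n) * weightedSlope Φ (u n) := by
    refine summable_of_sum_range_le (c := 2 * Φ (u 0))
      (fun n => mul_nonneg (hF.size_pos _).le (weightedSlope_nonneg _ _)) fun n => ?_
    have h1 : ∑ k ∈ Finset.range n, σ (u k) * weightedSlope Φ (u k)
        ≤ 2 * (Φ (u 0) - Φ (u n)) := by
      induction n with
      | zero => simp
      | succ n ih =>
        rw [Finset.sum_range_succ]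
        linarith [hdec n]
    have h2 : 0 ≤ Φ (u n) := h0 n
    linarith
  -- The total energy loss is finite while the total step size is infinite.
  have hfreq : ∀ δ : ℝ, 0 < δ → ∀ N, ∃ n, N ≤ n ∧ weightedSlope Φ (u n) < δ := by
    intro δ hδ N
    by_contra! hcon
    refine hF.not_summable_size hψ1 x ((summable_nat_add_iff N).1 ?_)
    refine Summable.of_nonneg_of_le (fun n => (hF.size_pos _).le) (fun n => ?_)
      (((summable_nat_add_iff N).2 hsum).mul_right δ⁻¹)
    have h1 := hcon (n + N) (Nat.le_add_left _ _)
    have h2 := hF.size_pos (u (n + N))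
    rw [← div_eq_mul_inv, le_div_iff₀ hδ]
    exact mul_le_mul_of_nonneg_left h1 h2.le
  obtain ⟨δ₁, hδ₁, hbdd⟩ := hgap.bounded
  have hm := hgap.pos
  have hM := hgap.nonneg
  obtain ⟨δ₂, hδ₂, hgap₂⟩ := hgap.gap (m / 4) (by positivity)
  set L := 1 + M + m with hL
  have hLpos : 0 < L := by positivity
  -- The cost of crossing from radius m/4 to radius m, positive because `s * L` is at most m/4.
  -- After time `N₀` less energy than this is left, so late almost critical points stay within m of
  -- one another and the gap property makes them Cauchy.
  set κ := δ₂ * (m - m / 4 - s * L) / (2 * L) with hκ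
  have hκpos : 0 < κ := div_pos (mul_pos hδ₂ (by linarith)) (by linarith)
  have hbelow : BddBelow (Set.range fun n => Φ (u n)) := ⟨0, by rintro _ ⟨n, rfl⟩; exact h0 n⟩
  have hlim := tendsto_atTop_ciInf hmono hbelow
  obtain ⟨N₀, hN₀⟩ := ((tendsto_order.1 hlim).2 ((⨅ n, Φ (u n)) + κ) (by linarith)).exists
  have henergy : ∀ n n', N₀ ≤ n → Φ (u n) - Φ (u n') < κ := by
    intro n n' hn
    have h1 : Φ (u n) ≤ Φ (u N₀) := hmono hn
    have h2 : (⨅ n, Φ (u n)) ≤ Φ (u n') := ciInf_le hbelow n'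
    linarith
  have hclose : ∀ n n', N₀ ≤ n → n ≤ n' → weightedSlope Φ (u n) < min δ₁ δ₂ →
      weightedSlope Φ (u n') < min δ₁ δ₂ → ‖u n' - u n‖ < m := by
    intro n n' hn hnn' hsn hsn'
    by_contra hcon
    have hz : ‖u n‖ ≤ M := hbdd _ (h0 n) (hβ n) (hsn.trans_le (min_le_left _ _))
    have := energy_le_of_crossing (u := u) (φ := fun n => Φ (u n)) (s := fun n => σ (u n))
      (z := u n) (ρ := m / 4) (R := m) (L := L) (δ := δ₂) (s₀ := s) hδ₂.le
      (fun n => (hF.size_pos _).le) (fun n => hF.size_le _) (by linarith) hLpos hstep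
      (fun n => hmono (Nat.le_succ n)) hnn' (fun k _ _ h1 h2 => ?_) (by simpa using by positivity)
      (not_lt.1 hcon)
    · exact absurd (henergy n n' hn) (not_lt.2 this)
    · have h3 : δ₂ ≤ weightedSlope Φ (u k) := by
        by_contra h
        exact absurd (hgap₂ (u k) (u n) (h0 k) (hβ k) (h0 n) (hβ n) (not_le.1 h)
          (hsn.trans_le (min_le_right _ _)) h2) (not_lt.2 h1)
      have h4 : σ (u k) * δ₂ ≤ σ (u k) * weightedSlope Φ (u k) :=
        mul_le_mul_of_nonneg_left h3 (hF.size_pos _).le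
      linarith [hdec k]
  choose n hnN hn using fun k : ℕ =>
    hfreq (min (min δ₁ δ₂) (1 / ((k : ℝ) + 1))) (lt_min (lt_min hδ₁ hδ₂) (by positivity)) N₀
  have hclose' : ∀ k l, ‖u (n k) - u (n l)‖ < m := by
    intro k l
    rcases le_total (n k) (n l) with h | h
    · rw [norm_sub_rev]
      exact hclose _ _ (hnN k) h ((hn k).trans_le (min_le_left _ _))
        ((hn l).trans_le (min_le_left _ _))
    · exact hclose _ _ (hnN l) h ((hn l).trans_le (min_le_left _ _))
        ((hn k).trans_le (min_le_left _ _))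
  have hn' : ∀ k, weightedSlope Φ (u (n k)) < 1 / ((k : ℝ) + 1) := fun k =>
    (hn k).trans_le (min_le_right _ _)
  have hcauchy : CauchySeq fun k => u (n k) := by
    rw [Metric.cauchySeq_iff]
    intro ε hε
    obtain ⟨δ, hδ, hg⟩ := hgap.gap ε hε
    obtain ⟨K, hK⟩ := exists_nat_one_div_lt hδ
    have hsm : ∀ k, K ≤ k → weightedSlope Φ (u (n k)) < δ := fun k hk =>
      ((hn' k).trans_le (one_div_le_one_div_of_le (by positivity) (by gcongr))).trans hK
    refine ⟨K, fun k hk l hl => ?_⟩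
    rw [dist_eq_norm]
    exact hg _ _ (h0 _) (hβ _) (h0 _) (hβ _) (hsm k hk) (hsm l hl) (hclose' k l)
  obtain ⟨w, hw⟩ := cauchySeq_tendsto_of_complete hcauchy
  refine ⟨w, mem_closure_of_tendsto hw (Eventually.of_forall fun k => ⟨n k, rfl⟩), ?_⟩
  rw [← weightedSlope_eq_zero_iff]
  have h1 : Tendsto (fun k => weightedSlope Φ (u (n k))) atTop (𝓝 (weightedSlope Φ w)) :=
    ((continuous_weightedSlope hc).tendsto w).comp hw
  have h2 : Tendsto (fun k => weightedSlope Φ (u (n k))) atTop (𝓝 0) :=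
    squeeze_zero (fun k => weightedSlope_nonneg _ _) (fun k => (hn' k).le)
      tendsto_one_div_add_atTop_nhds_zero_nat
  exact tendsto_nhds_unique h1 h2

/-- A cutoff function for the descent from the level `a'` to the level `a`. -/
lemma exists_cutoff {Φ : H → ℝ} (hΦ : Continuous Φ) (hc : Continuous (fderiv ℝ Φ)) {a a' : ℝ}
    (haa' : a < a') {O : Set H} (hO : IsOpen O)
    (hcrit : ∀ u, fderiv ℝ Φ u = 0 → a ≤ Φ u → u ∈ O) :
    ∃ ψ : H → ℝ, Continuous ψ ∧ (∀ u, 0 ≤ ψ u) ∧ (∀ u, ψ u ≤ 1) ∧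
      (∀ u ∈ tsupport ψ, fderiv ℝ Φ u ≠ 0) ∧ (∀ u, Φ u ≤ a → ψ u = 0) ∧
      (∀ u, a' ≤ Φ u → u ∉ O → ψ u = 1) ∧
      ((∀ u, Φ (-u) = Φ u) → (∀ u, u ∈ O → -u ∈ O) → ∀ u, ψ (-u) = ψ u) := by
  classical
  have hK : IsClosed {u | fderiv ℝ Φ u = 0 ∧ a ≤ Φ u} :=
    (isClosed_eq hc continuous_const).inter (isClosed_le continuous_const hΦ)
  -- The smaller neighbourhood makes the cutoff vanish near critical points, so that even its closed
  -- support avoids them.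
  obtain ⟨O', hO', hKO', hO'O⟩ := normal_exists_closure_subset hK hO fun u hu => hcrit u hu.1 hu.2
  obtain ⟨f, hf0, hf1, hf⟩ := exists_continuous_zero_one_of_isClosed
    (s := {u | Φ u ≤ a} ∪ closure O') (t := {u | a' ≤ Φ u} ∩ Oᶜ)
    ((isClosed_le hΦ continuous_const).union isClosed_closure)
    ((isClosed_le continuous_const hΦ).inter hO.isClosed_compl) (by
      rw [Set.disjoint_left]
      rintro u (hu | hu) ⟨h1, h2⟩
      · have h3 : Φ u ≤ a := hu
        have h4 : a' ≤ Φ u := h1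
        linarith
      · exact h2 (hO'O hu))
  have key : ∀ ψ : H → ℝ, (∀ u, f u = 0 → ψ u = 0) → ∀ u ∈ tsupport ψ, fderiv ℝ Φ u ≠ 0 := by
    intro ψ hψ u hu hu0
    have hev : ∀ᶠ v in 𝓝 u, f v = 0 := by
      rcases lt_or_ge (Φ u) a with h | h
      · filter_upwards [(isOpen_lt hΦ continuous_const).mem_nhds h] with v hv
        exact hf0 (Or.inl (le_of_lt hv))
      · filter_upwards [hO'.mem_nhds (hKO' ⟨hu0, h⟩)] with v hv
        exact hf0 (Or.inr (subset_closure hv))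
    rw [tsupport, mem_closure_iff_frequently] at hu
    obtain ⟨v, hv1, hv2⟩ := (hu.and_eventually hev).exists
    exact hv1 (hψ v hv2)
  -- This is min(f(u), f(-u)) in the symmetric case and f(u) otherwise; unsymmetric data would not
  -- allow f(-u) to enter.
  refine ⟨fun u => min (f u) (max (f (-u)) (if (∀ u, Φ (-u) = Φ u) ∧ (∀ u, u ∈ O → -u ∈ O)
    then 0 else 1)), ?_, ?_, ?_, ?_, ?_, ?_, ?_⟩
  · fun_prop
  · exact fun u => le_min (hf u).1 ((hf (-u)).1.trans (le_max_left _ _))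
  · exact fun u => (min_le_left _ _).trans (hf u).2
  · refine key _ fun u hu => ?_
    rw [hu, min_eq_left ((hf (-u)).1.trans (le_max_left _ _))]
  · intro u hu
    have : f u = 0 := hf0 (Or.inl hu)
    simp only [this]
    exact min_eq_left ((hf (-u)).1.trans (le_max_left _ _))
  · intro u hu huO
    have h1 : f u = 1 := hf1 ⟨hu, huO⟩
    by_cases h : (∀ u, Φ (-u) = Φ u) ∧ (∀ u, u ∈ O → -u ∈ O)
    · have h2 : f (-u) = 1 := by
        refine hf1 ⟨?_, fun hu' => huO ?_⟩
        · change a' ≤ Φ (-u)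
          rwa [h.1]
        · simpa using h.2 _ hu'
      simp [h1, h2]
    · simp only [if_neg h, h1]
      rw [max_eq_right (hf (-u)).2, min_self]
  · intro h1 h2 u
    have h : (∀ u, Φ (-u) = Φ u) ∧ (∀ u, u ∈ O → -u ∈ O) := ⟨h1, h2⟩
    simp only [if_pos h, neg_neg]
    rw [max_eq_left (hf (-u)).1, max_eq_left (hf u).1, min_comm]

/-- Deformation lemma: the iterates of a descent step bring every point of level at most `β` below
the level `a'` or into the neighbourhood `O` of the critical points. -/
theorem exists_descent_map (hd : Differentiable ℝ Φ) (hc : Continuous (fderiv ℝ Φ))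
    (hgap : HasDiscreteAlmostCritical Φ β m M) {a a' : ℝ} (ha' : 0 ≤ a') (haa' : a < a')
    (hs0 : 0 < s) (hs : s * (1 + M + m) ≤ m / 4) {O : Set H} (hO : IsOpen O)
    (hcrit : ∀ u, fderiv ℝ Φ u = 0 → a ≤ Φ u → u ∈ O) :
    ∃ (ψ : H → ℝ) (F : H → H) (σ : H → ℝ), IsDescentStep Φ ψ s F σ ∧
      (∀ u, 0 ≤ ψ u) ∧ (∀ u, ψ u ≤ 1) ∧ (∀ u, a' ≤ Φ u → u ∉ O → ψ u = 1) ∧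
      (∀ u, Φ u ≤ a → F u = u) ∧
      (∀ u, Φ u ≤ β → ∃ n, Φ (F^[n] u) < a' ∨ F^[n] u ∈ O) ∧
      ((∀ u, Φ (-u) = Φ u) → (∀ u, u ∈ O → -u ∈ O) → ∀ u, F (-u) = -F u) := by
  obtain ⟨ψ, hψ, hψ0, hψ1, hψc, hψa, hψo, hψe⟩ :=
    exists_cutoff hd.continuous hc haa' hO hcrit
  obtain ⟨F, σ, hF, hodd⟩ := exists_isDescentStep hd hc hψ hψ0 hψ1 hψc hs0
  refine ⟨ψ, F, σ, hF, hψ0, hψ1, hψo, fun u hu => ?_, fun u hu => ?_,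
    fun h1 h2 => hodd h1 (hψe h1 h2)⟩
  · have h := hF.norm_sub_le u
    rw [hψa u hu, mul_zero, zero_mul] at h
    exact sub_eq_zero.1 (norm_le_zero_iff.1 h)
  -- Otherwise ψ = 1 along the whole trajectory; it accumulates at a critical point of level at
  -- least a' outside O, and there is none.
  · by_contra! hcon
    have hmono := hF.iterate_antitone hψ0 u
    obtain ⟨w, hw, hw0⟩ := hF.exists_critical_mem_closure hψ0 hψ1 hc hgap hs (x := u)
      (fun n => ha'.trans (hcon n).1) (fun n => (hmono (Nat.zero_le n)).trans hu)
      (fun n => hψo _ (hcon n).1 (hcon n).2)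
    have hsub : closure (Set.range fun n => F^[n] u) ⊆ {v | a' ≤ Φ v} ∩ Oᶜ := by
      refine closure_minimal ?_
        ((isClosed_le continuous_const hd.continuous).inter hO.isClosed_compl)
      rintro _ ⟨n, rfl⟩
      exact hcon n
    obtain ⟨h1, h2⟩ := hsub hw
    exact h2 (hcrit w hw0 (haa'.le.trans h1))

end Descent

/-! ### Mod 2 chains, prisms and cup products of coboundaries -/

section Chains

variable {V W : Type*}

/-- The sum of a mod 2 cochain over the faces of a tuple; the face of a single vertex is `[]`. -/
def faceSum (φ : List V → ZMod 2) : List V → ZMod 2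
  | [] => 0
  | v :: l => φ l + faceSum (fun t => φ (v :: t)) l

/-- The tuples `[f v₀, …, f vᵢ, g vᵢ, …, g v_d]` of the prism between two images of a tuple. -/
def prism (f g : V → W) : List V → List (List W)
  | [] => []
  | v :: l => (f v :: g v :: l.map g) :: (prism f g l).map (List.cons (f v))

/-- The value of a mod 2 cochain on a mod 2 chain. -/
def evalChain (φ : List V → ZMod 2) (c : List (List V)) : ZMod 2 := (c.map φ).sum

@[simp] lemma evalChain_nil (φ : List V → ZMod 2) : evalChain φ [] = 0 := rfl

@[simp] lemma evalChain_cons (φ : List V → ZMod 2) (l : List V) (c : List (List V)) :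
    evalChain φ (l :: c) = φ l + evalChain φ c := by simp [evalChain]

@[simp] lemma evalChain_append (φ : List V → ZMod 2) (c d : List (List V)) :
    evalChain φ (c ++ d) = evalChain φ c + evalChain φ d := by simp [evalChain]

lemma evalChain_map (φ : List W → ZMod 2) (f : List V → List W) (c : List (List V)) :
    evalChain φ (c.map f) = evalChain (fun l => φ (f l)) c := by
  simp [evalChain, Function.comp_def]

lemma evalChain_flatMap {α : Type*} (φ : List W → ZMod 2) (f : α → List (List W)) (c : List α) :
    evalChain φ (c.flatMap f) = (c.map fun a => evalChain φ (f a)).sum := by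
  induction c with
  | nil => rfl
  | cons l c ih => simp [List.flatMap_cons, ih]

lemma evalChain_add (φ ψ : List V → ZMod 2) (c : List (List V)) :
    evalChain (fun l => φ l + ψ l) c = evalChain φ c + evalChain ψ c := by
  induction c with
  | nil => simp
  | cons l c ih => simp only [evalChain_cons, ih]; ring

lemma evalChain_congr {φ ψ : List V → ZMod 2} {c : List (List V)} (h : ∀ l ∈ c, φ l = ψ l) :
    evalChain φ c = evalChain ψ c := by
  simp only [evalChain, List.map_congr_left h]

lemma evalChain_eq_zero {φ : List V → ZMod 2} {c : List (List V)} (h : ∀ l ∈ c, φ l = 0) :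
    evalChain φ c = 0 := by
  rw [evalChain_congr h]; simp [evalChain]

lemma zmod_two_add_self (a : ZMod 2) : a + a = 0 := CharTwo.add_self_eq_zero a

lemma faceSum_add (φ ψ : List V → ZMod 2) (l : List V) :
    faceSum (fun t => φ t + ψ t) l = faceSum φ l + faceSum ψ l := by
  induction l generalizing φ ψ with
  | nil => simp [faceSum]
  | cons v l ih => simp only [faceSum, ih]; ring

lemma faceSum_map (φ : List W → ZMod 2) (g : V → W) (l : List V) :
    faceSum φ (l.map g) = faceSum (fun t => φ (t.map g)) l := by
  induction l generalizing φ with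
  | nil => rfl
  | cons v l ih => simp only [faceSum, List.map_cons, ih]

/-- The prism operator is a chain homotopy between the maps induced by `f` and `g`. -/
lemma prism_homotopy (f g : V → W) (φ : List W → ZMod 2) (l : List V) :
    evalChain (faceSum φ) (prism f g l) + faceSum (fun t => evalChain φ (prism f g t)) l
      = φ (l.map g) + φ (l.map f) := by
  induction l generalizing φ with
  | nil => simp [prism, faceSum, zmod_two_add_self]
  | cons v l ih =>
    have h := ih (fun t => φ (f v :: t))
    simp only [prism, faceSum, evalChain_cons, evalChain_map, evalChain_add, faceSum_add,
      faceSum_map, List.map_cons] at h ⊢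
    linear_combination h + zmod_two_add_self (evalChain φ (prism f g l)) +
      zmod_two_add_self (faceSum (fun t => φ (f v :: g v :: t.map g)) l) +
      zmod_two_add_self (φ (f v :: l.map g))

lemma length_of_mem_prism {f g : V → W} {l : List V} {t : List W} (h : t ∈ prism f g l) :
    t.length = l.length + 1 := by
  induction l generalizing t with
  | nil => simp [prism] at h
  | cons v l ih =>
    simp only [prism, List.mem_cons, List.mem_map] at h
    rcases h with rfl | ⟨s, hs, rfl⟩
    · simp
    · simp [ih hs]

lemma exists_of_mem_prism {f g : V → W} {l : List V} {t : List W} (h : t ∈ prism f g l)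
    {w : W} (hw : w ∈ t) : ∃ v ∈ l, w = f v ∨ w = g v := by
  induction l generalizing t with
  | nil => simp [prism] at h
  | cons v l ih =>
    simp only [prism, List.mem_cons, List.mem_map] at h
    rcases h with rfl | ⟨s, hs, rfl⟩
    · simp only [List.mem_cons, List.mem_map] at hw
      rcases hw with rfl | rfl | ⟨u, hu, rfl⟩
      · exact ⟨v, by simp, Or.inl rfl⟩
      · exact ⟨v, by simp, Or.inr rfl⟩
      · exact ⟨u, by simp [hu], Or.inr rfl⟩
    · rcases List.mem_cons.1 hw with rfl | hw
      · exact ⟨v, by simp, Or.inl rfl⟩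
      · obtain ⟨u, hu, h⟩ := ih hs hw
        exact ⟨u, by simp [hu], h⟩

/-- The chain swept out by `c` along the maps `g 0, …, g N`. -/
def sweep (g : ℕ → V → W) (N : ℕ) (c : List (List V)) : List (List W) :=
  (List.range N).flatMap fun k => c.flatMap (prism (g k) (g (k + 1)))

lemma mem_sweep {g : ℕ → V → W} {N : ℕ} {c : List (List V)} {t : List W} :
    t ∈ sweep g N c ↔ ∃ k < N, ∃ l ∈ c, t ∈ prism (g k) (g (k + 1)) l := by
  simp [sweep]

lemma sweep_succ (g : ℕ → V → W) (N : ℕ) (c : List (List V)) :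
    sweep g (N + 1) c = sweep g N c ++ c.flatMap (prism (g N) (g (N + 1))) := by
  simp [sweep, List.range_succ]

/-- For a cycle the side faces of each prism cancel, and the intermediate copies of c telescope mod
2. -/
lemma evalChain_faceSum_sweep (g : ℕ → V → W) (N : ℕ) (c : List (List V))
    (hc : ∀ φ, evalChain (faceSum φ) c = 0) (φ : List W → ZMod 2) :
    evalChain (faceSum φ) (sweep g N c)
      = evalChain (fun l => φ (l.map (g N))) c + evalChain (fun l => φ (l.map (g 0))) c := by
  induction N with
  | zero => simp [sweep, zmod_two_add_self]
  | succ N ih =>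
    have h : evalChain (fun l => evalChain (faceSum φ) (prism (g N) (g (N + 1)) l)) c
        = evalChain (fun l => φ (l.map (g (N + 1)))) c + evalChain (fun l => φ (l.map (g N))) c := by
      have h1 := evalChain_congr (c := c) (fun l _ => prism_homotopy (g N) (g (N + 1)) φ l)
      rw [evalChain_add, evalChain_add, hc, add_zero] at h1
      exact h1
    rw [sweep_succ, evalChain_append, ih, evalChain_flatMap]
    change _ + evalChain (fun l => evalChain (faceSum φ) (prism (g N) (g (N + 1)) l)) c = _
    rw [h]
    linear_combination zmod_two_add_self (evalChain (fun l => φ (l.map (g N))) c)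

/-- The product of the `δ εᵢ` along the edges of a tuple. -/
def edgeProd (ε : ℕ → V → ZMod 2) : ℕ → List V → ZMod 2
  | 0, _ => 1
  | d + 1, v :: u :: l => (ε d v + ε d u) * edgeProd ε d (u :: l)
  | _ + 1, _ => 0

/-- The cochain `ε_d ∪ δ ε_{d-1} ∪ … ∪ δ ε_0`. -/
def cupCochain (ε : ℕ → V → ZMod 2) (d : ℕ) : List V → ZMod 2
  | [] => 0
  | v :: l => ε d v * edgeProd ε d (v :: l)

lemma faceSum_mul_left (a : ZMod 2) (φ : List V → ZMod 2) (l : List V) :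
    faceSum (fun t => a * φ t) l = a * faceSum φ l := by
  induction l generalizing φ with
  | nil => simp [faceSum]
  | cons v l ih => simp only [faceSum, ih]; ring

/-- The cocycle property of a product of coboundaries, with the face that drops v moved to the
right. -/
lemma faceSum_edgeProd (ε : ℕ → V → ZMod 2) (d : ℕ) (l : List V) (v : V)
    (hl : l.length = d + 1) :
    faceSum (fun t => edgeProd ε d (v :: t)) l = edgeProd ε d l := by
  induction d generalizing l v with
  | zero =>
    obtain ⟨u, rfl⟩ := List.length_eq_one_iff.1 hl
    simp [faceSum, edgeProd]
  | succ d ih =>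
    obtain ⟨u, l, rfl⟩ := List.exists_cons_of_length_eq_add_one hl
    obtain ⟨w, l, rfl⟩ := List.exists_cons_of_length_eq_add_one (Nat.succ.inj hl)
    have hl' : (w :: l).length = d + 1 := Nat.succ.inj hl
    have h1 := ih (w :: l) u hl'
    have h2 : faceSum (fun t => edgeProd ε (d + 1) (v :: u :: t)) (w :: l)
        = (ε d v + ε d u) * edgeProd ε d (w :: l) := by
      rw [← h1, ← faceSum_mul_left]
      rfl
    rw [faceSum, h2]
    simp only [edgeProd]
    linear_combination zmod_two_add_self (ε d v) * edgeProd ε d (w :: l)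

/-- Leibniz rule: only the first factor has a nonzero coboundary. -/
lemma faceSum_cupCochain (ε : ℕ → V → ZMod 2) (d : ℕ) (l : List V) (hl : l.length = d + 2) :
    faceSum (cupCochain ε d) l = edgeProd ε (d + 1) l := by
  obtain ⟨v, l, rfl⟩ := List.exists_cons_of_length_eq_add_one hl
  obtain ⟨u, l, rfl⟩ := List.exists_cons_of_length_eq_add_one (Nat.succ.inj hl)
  have hl' : (u :: l).length = d + 1 := Nat.succ.inj hl
  have h := faceSum_edgeProd ε d (u :: l) v hl'
  have h2 : faceSum (fun t => cupCochain ε d (v :: t)) (u :: l)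
      = ε d v * edgeProd ε d (u :: l) := by
    rw [← h, ← faceSum_mul_left]
    rfl
  rw [faceSum, h2]
  simp only [edgeProd, cupCochain]
  ring

lemma edgeProd_eq_zero (ε : ℕ → V → ZMod 2) {d i : ℕ} (hi : i < d) {l : List V}
    (h : ∀ x ∈ l, ∀ y ∈ l, ε i x = ε i y) : edgeProd ε d l = 0 := by
  induction d generalizing l with
  | zero => omega
  | succ d ih =>
    match l with
    | [] => rfl
    | [_] => rfl
    | v :: u :: l =>
      simp only [edgeProd]
      rcases Nat.lt_succ_iff_lt_or_eq.1 hi with hi | rfl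
      · rw [ih hi fun x hx y hy => h x (List.mem_cons_of_mem _ hx) y (List.mem_cons_of_mem _ hy),
          mul_zero]
      · rw [h v (by simp) u (by simp), zmod_two_add_self, zero_mul]

lemma edgeProd_map_neg [Neg V] (ε : ℕ → V → ZMod 2) (d : ℕ) {l : List V}
    (h : ∀ i < d, ∀ x ∈ l, ε i x + ε i (-x) = 1) :
    edgeProd ε d (l.map Neg.neg) = edgeProd ε d l := by
  induction d generalizing l with
  | zero => rfl
  | succ d ih =>
    match l with
    | [] => rfl
    | [_] => rfl
    | v :: u :: l =>
      have h1 := ih (l := u :: l) fun i hi x hx =>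
        h i (by omega) x (List.mem_cons_of_mem _ hx)
      have hv := h d (by omega) v (by simp)
      have hu := h d (by omega) u (by simp)
      simp only [edgeProd, List.map_cons] at h1 ⊢
      rw [h1]
      linear_combination (edgeProd ε d (u :: l)) * (hv - hu) -
        (edgeProd ε d (u :: l)) * zmod_two_add_self (ε d v) +
        (edgeProd ε d (u :: l)) * zmod_two_add_self (ε d (-u))

/-- The antipode adds 1 to each odd cochain, so it fixes the coboundaries and changes only the
leading factor. -/
lemma cupCochain_add_map_neg [Neg V] (ε : ℕ → V → ZMod 2) (d : ℕ) {l : List V} (hl : l ≠ [])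
    (h : ∀ i ≤ d, ∀ x ∈ l, ε i x + ε i (-x) = 1) :
    cupCochain ε d l + cupCochain ε d (l.map Neg.neg) = edgeProd ε d l := by
  obtain ⟨v, l, rfl⟩ := List.exists_cons_of_ne_nil hl
  have h1 := edgeProd_map_neg ε d (l := v :: l) fun i hi x hx => h i hi.le x hx
  have hv := h d le_rfl v (by simp)
  rw [List.map_cons] at h1 ⊢
  simp only [cupCochain, h1]
  linear_combination edgeProd ε d (v :: l) * hv

end Chains

lemma length_of_mem_sweep {V W : Type*} {g : ℕ → V → W} {N d : ℕ} {c : List (List V)}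
    (hc : ∀ l ∈ c, l.length = d) {t : List W} (ht : t ∈ sweep g N c) : t.length = d + 1 := by
  obtain ⟨k, hk, l, hl, ht⟩ := mem_sweep.1 ht
  rw [length_of_mem_prism ht, hc l hl]

/-! ### Symmetric chains and their contraction to a point -/

section Symmetric

variable {E : Type*} [NormedAddCommGroup E]

/-- A chain together with its image under `x ↦ -x`. -/
def symmChain (c : List (List E)) : List (List E) := c ++ c.map (List.map Neg.neg)

lemma evalChain_symmChain (φ : List E → ZMod 2) (c : List (List E)) :
    evalChain φ (symmChain c) = evalChain (fun l => φ l + φ (l.map Neg.neg)) c := by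
  rw [symmChain, evalChain_append, evalChain_map, evalChain_add]

lemma forall_mem_symmChain {c : List (List E)} {P : List E → Prop} (h : ∀ l ∈ c, P l)
    (hneg : ∀ l, P l → P (l.map Neg.neg)) : ∀ l ∈ symmChain c, P l := by
  intro l hl
  rcases List.mem_append.1 hl with hl | hl
  · exact h l hl
  · obtain ⟨t, ht, rfl⟩ := List.mem_map.1 hl
    exact hneg t (h t ht)

lemma map_map_neg (l : List E) : (l.map Neg.neg).map Neg.neg = l := by simp

lemma evalChain_symmChain_comp_neg (φ : List E → ZMod 2) (c : List (List E)) :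
    evalChain (fun l => φ (l.map Neg.neg)) (symmChain c) = evalChain φ (symmChain c) := by
  rw [evalChain_symmChain, evalChain_symmChain]
  refine evalChain_congr fun l _ => ?_
  rw [map_map_neg, add_comm]

end Symmetric

section Sweeping

variable {E : Type*} [NormedAddCommGroup E] [NormedSpace ℝ E]

/-- The `k`-th of `N` steps of the straight homotopy from the identity to the constant `q`. -/
def contraction (q : E) (N k : ℕ) (x : E) : E := x + (k / N : ℝ) • (q - x)

lemma contraction_zero (q : E) (N : ℕ) : contraction q N 0 = id := by
  ext x; simp [contraction]

lemma contraction_self (q : E) {N : ℕ} (hN : 0 < N) (x : E) : contraction q N N x = q := by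
  have : (N : ℝ) ≠ 0 := by positivity
  simp [contraction, div_self this]

lemma norm_contraction_sub_contraction_le (q : E) {N k : ℕ} (hk : k ≤ N) (x y : E) :
    ‖contraction q N k x - contraction q N k y‖ ≤ ‖x - y‖ := by
  have h0 : (0 : ℝ) ≤ k / N := by positivity
  have h1 : (k / N : ℝ) ≤ 1 := div_le_one_of_le₀ (by exact_mod_cast hk) (by positivity)
  have h : contraction q N k x - contraction q N k y = (1 - (k / N : ℝ)) • (x - y) := by
    simp only [contraction]; module
  rw [h, norm_smul, Real.norm_of_nonneg (by linarith)]
  exact mul_le_of_le_one_left (norm_nonneg _) (by linarith)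

lemma norm_contraction_succ_sub_le {q x : E} (hq : ‖q‖ ≤ 1) (hx : ‖x‖ ≤ 1) (N k : ℕ) :
    ‖contraction q N (k + 1) x - contraction q N k x‖ ≤ 2 / N := by
  have h : contraction q N (k + 1) x - contraction q N k x = (1 / N : ℝ) • (q - x) := by
    have h2 : ((k + 1 : ℕ) / N : ℝ) = k / N + 1 / N := by push_cast; ring
    simp only [contraction, h2]; module
  rw [h, norm_smul, Real.norm_of_nonneg (by positivity)]
  have := norm_sub_le q x
  calc (1 / N : ℝ) * ‖q - x‖ ≤ (1 / N : ℝ) * 2 := by gcongr; linarith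
    _ = 2 / N := by ring

lemma dist_of_mem_sweep_contraction {q : E} (hq : ‖q‖ ≤ 1) {N : ℕ} {c : List (List E)} {ρ : ℝ}
    (hc : ∀ l ∈ c, ∀ x ∈ l, ‖x‖ ≤ 1) (hρ : ∀ l ∈ c, ∀ x ∈ l, ∀ y ∈ l, ‖x - y‖ ≤ ρ)
    {t : List E} (ht : t ∈ sweep (contraction q N) N c) {x y : E} (hx : x ∈ t) (hy : y ∈ t) :
    ‖x - y‖ ≤ ρ + 2 / N := by
  obtain ⟨k, hk, l, hl, ht⟩ := mem_sweep.1 ht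
  have key : ∀ i, (i = k ∨ i = k + 1) → ∀ j, (j = k ∨ j = k + 1) → ∀ u ∈ l, ∀ v ∈ l,
      ‖contraction q N i u - contraction q N j v‖ ≤ ρ + 2 / N := by
    intro i hi j hj u hu v hv
    have h1 : ‖contraction q N i u - contraction q N i v‖ ≤ ρ :=
      (norm_contraction_sub_contraction_le q (by omega) u v).trans (hρ l hl u hu v hv)
    have h2 : ‖contraction q N i v - contraction q N j v‖ ≤ 2 / N := by
      rcases hi with rfl | rfl <;> rcases hj with rfl | rfl
      · rw [sub_self, norm_zero]; positivity
      · rw [norm_sub_rev]; exact norm_contraction_succ_sub_le hq (hc l hl v hv) _ _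
      · exact norm_contraction_succ_sub_le hq (hc l hl v hv) _ _
      · rw [sub_self, norm_zero]; positivity
    calc _ = ‖(contraction q N i u - contraction q N i v)
          + (contraction q N i v - contraction q N j v)‖ := by congr 1; abel
      _ ≤ _ := (norm_add_le _ _).trans (add_le_add h1 h2)
  obtain ⟨u, hu, hu'⟩ := exists_of_mem_prism ht hx
  obtain ⟨v, hv, hv'⟩ := exists_of_mem_prism ht hy
  rcases hu' with rfl | rfl <;> rcases hv' with rfl | rfl
  · exact key _ (Or.inl rfl) _ (Or.inl rfl) _ hu _ hv
  · exact key _ (Or.inl rfl) _ (Or.inr rfl) _ hu _ hv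
  · exact key _ (Or.inr rfl) _ (Or.inl rfl) _ hu _ hv
  · exact key _ (Or.inr rfl) _ (Or.inr rfl) _ hu _ hv

lemma exists_of_mem_sweep_contraction {q : E} {N : ℕ} {c : List (List E)}
    {t : List E} (ht : t ∈ sweep (contraction q N) N c) {x : E} (hx : x ∈ t) :
    ∃ l ∈ c, ∃ v ∈ l, ∃ k ≤ N, x = contraction q N k v := by
  obtain ⟨k, hk, l, hl, ht⟩ := mem_sweep.1 ht
  obtain ⟨v, hv, rfl | rfl⟩ := exists_of_mem_prism ht hx
  · exact ⟨l, hl, v, hv, k, hk.le, rfl⟩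
  · exact ⟨l, hl, v, hv, k + 1, hk, rfl⟩

/-- At the end of the contraction a tuple and its antipode collapse to the same constant tuple and
cancel; only the initial cycle remains as boundary. -/
lemma evalChain_faceSum_sweep_contraction (q : E) {N : ℕ} (hN : 0 < N) {c : List (List E)}
    (hc : ∀ φ, evalChain (faceSum φ) (symmChain c) = 0)
    (φ : List E → ZMod 2) :
    evalChain (faceSum φ) (sweep (contraction q N) N (symmChain c)) = evalChain φ (symmChain c) := by
  rw [evalChain_faceSum_sweep _ _ _ hc]
  have h : evalChain (fun l => φ (l.map (contraction q N N))) (symmChain c) = 0 := by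
    rw [evalChain_symmChain]
    refine evalChain_eq_zero fun l hl => ?_
    have : contraction q N N = fun _ => q := funext (contraction_self q hN)
    simp only [this, List.map_map]
    exact zmod_two_add_self _
  rw [h, contraction_zero, zero_add]
  simp

end Sweeping

/-! ### A Borsuk–Ulam theorem on the ℓ¹ ball -/

section Sphere

variable {n : ℕ}

/-- The `ℓ¹` norm. -/
def l1 (x : Fin n → ℝ) : ℝ := ∑ i, |x i|

lemma l1_nonneg (x : Fin n → ℝ) : 0 ≤ l1 x := Finset.sum_nonneg fun _ _ => abs_nonneg _

lemma l1_neg (x : Fin n → ℝ) : l1 (-x) = l1 x := by simp [l1]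

lemma l1_zero : l1 (0 : Fin n → ℝ) = 0 := by simp [l1]

lemma continuous_l1 : Continuous (l1 : (Fin n → ℝ) → ℝ) := by unfold l1; fun_prop

lemma norm_le_l1 (x : Fin n → ℝ) : ‖x‖ ≤ l1 x :=
  (pi_norm_le_iff_of_nonneg (l1_nonneg x)).2 fun i =>
    Finset.single_le_sum (f := fun i => |x i|) (fun _ _ => abs_nonneg _) (Finset.mem_univ i)

lemma isCompact_l1_le (R : ℝ) : IsCompact {x : Fin n → ℝ | l1 x ≤ R} := by
  refine Metric.isCompact_of_isClosed_isBounded (isClosed_le continuous_l1 continuous_const) ?_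
  refine (Metric.isBounded_closedBall (x := 0) (r := R)).subset fun x hx => ?_
  rw [mem_closedBall_zero_iff]
  exact (norm_le_l1 x).trans hx

lemma l1_smul (a : ℝ) (x : Fin n → ℝ) : l1 (a • x) = |a| * l1 x := by
  simp [l1, abs_mul, Finset.mul_sum]

lemma l1_single (i : Fin n) (a : ℝ) : l1 (Pi.single i a) = |a| := by
  rw [l1, Finset.sum_eq_single i] <;> simp +contextual

/-- The chains realizing the hemispheres of the `ℓ¹` spheres of the coordinate subspaces, with
vertices of small mutual distance, and the value on them of a cup product of coboundaries of
odd cochains. -/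
lemma exists_chain_l1_sphere (ε : ℕ → (Fin n → ℝ) → ZMod 2)
    (hε : ∀ i < n, ∀ x, l1 x = 1 → ε i x + ε i (-x) = 1) {N : ℕ} (hN : 0 < N) (d : ℕ) (hd : d < n) :
    ∃ c : List (List (Fin n → ℝ)),
      (∀ l ∈ c, l.length = d + 1) ∧
      (∀ l ∈ c, ∀ x ∈ l, l1 x = 1 ∧ ∀ j : Fin n, d < j → x j = 0) ∧
      (∀ l ∈ c, ∀ x ∈ l, ∀ y ∈ l, ‖x - y‖ ≤ d * (2 / N)) ∧
      (∀ φ, evalChain (faceSum φ) (symmChain c) = 0) ∧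
      evalChain (cupCochain ε d) (symmChain c) = 1 := by
  induction d with
  | zero =>
    have h1 : l1 (Pi.single (⟨0, hd⟩ : Fin n) (1 : ℝ)) = 1 := by simp [l1_single]
    refine ⟨[[Pi.single ⟨0, hd⟩ 1]], by simp, ?_, by simp, ?_, ?_⟩
    · simp only [List.mem_singleton, forall_eq]
      refine ⟨h1, fun j hj => Pi.single_eq_of_ne (fun h => ?_) _⟩
      simp [h] at hj
    · intro φ
      simp [symmChain, faceSum, zmod_two_add_self]
    · have := hε 0 hd _ h1
      simpa [symmChain, cupCochain, edgeProd] using this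
  | succ d ih =>
    obtain ⟨c, hlen, hsph, hdist, hcyc, hval⟩ := ih (by omega)
    set q : Fin n → ℝ := Pi.single ⟨d + 1, hd⟩ 1 with hq
    have hq1 : l1 q = 1 := by simp [q, l1_single]
    have hqn : ‖q‖ ≤ 1 := (norm_le_l1 q).trans hq1.le
    -- The next hemisphere is the cone over the previous sphere with apex the new unit vector. It
    -- stays on the ℓ¹ sphere, as that norm is additive on disjoint supports.
    set c' := sweep (contraction q N) N (symmChain c) with hc'
    have hlen' : ∀ l ∈ symmChain c, l.length = d + 1 :=
      forall_mem_symmChain hlen fun l hl => by simpa using hl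
    have hsph' : ∀ l ∈ symmChain c, ∀ x ∈ l, l1 x = 1 ∧ ∀ j : Fin n, d < j → x j = 0 := by
      refine forall_mem_symmChain hsph fun l hl x hx => ?_
      obtain ⟨y, hy, rfl⟩ := List.mem_map.1 hx
      obtain ⟨h1, h2⟩ := hl y hy
      exact ⟨by rw [l1_neg, h1], fun j hj => by simp [h2 j hj]⟩
    have hdist' : ∀ l ∈ symmChain c, ∀ x ∈ l, ∀ y ∈ l, ‖x - y‖ ≤ d * (2 / N) := by
      refine forall_mem_symmChain hdist fun l hl _ hx _ hy => ?_
      obtain ⟨u, hu, rfl⟩ := List.mem_map.1 hx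
      obtain ⟨v, hv, rfl⟩ := List.mem_map.1 hy
      have : -u - -v = -(u - v) := by abel
      rw [this, norm_neg]
      exact hl u hu v hv
    have hnorm : ∀ l ∈ symmChain c, ∀ x ∈ l, ‖x‖ ≤ 1 := fun l hl x hx =>
      (norm_le_l1 x).trans (hsph' l hl x hx).1.le
    have hL : ∀ l ∈ c', l.length = d + 1 + 1 := fun l hl => length_of_mem_sweep hlen' hl
    have hS : ∀ l ∈ c', ∀ x ∈ l, l1 x = 1 ∧ ∀ j : Fin n, d + 1 < j → x j = 0 := by
      intro t ht x hx
      obtain ⟨l, hl, v, hv, k, hk, rfl⟩ := exists_of_mem_sweep_contraction ht hx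
      obtain ⟨hv1, hv2⟩ := hsph' l hl v hv
      have h0 : (0 : ℝ) ≤ k / N := by positivity
      have h1 : (k / N : ℝ) ≤ 1 := div_le_one_of_le₀ (by exact_mod_cast hk) (by positivity)
      constructor
      · have key : ∀ i, |contraction q N k v i| = (1 - (k / N : ℝ)) * |v i| + (k / N : ℝ) * |q i| := by
          intro i
          have e : contraction q N k v i = (1 - (k / N : ℝ)) * v i + (k / N : ℝ) * q i := by
            simp [contraction]; ring
          rcases eq_or_ne i ⟨d + 1, hd⟩ with rfl | hi
          · rw [e, hv2 _ (by simp)]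
            simp [q, abs_of_nonneg h0]
          · have : q i = 0 := Pi.single_eq_of_ne hi _
            rw [e, this]
            simp [abs_mul, abs_of_nonneg (sub_nonneg.2 h1)]
        have : l1 (contraction q N k v) = (1 - (k / N : ℝ)) * l1 v + (k / N : ℝ) * l1 q := by
          simp only [l1, key, Finset.sum_add_distrib, Finset.mul_sum]
        rw [this, hv1, hq1]; ring
      · intro j hj
        have h3 : v j = 0 := hv2 j (by omega)
        have h4 : q j = 0 := Pi.single_eq_of_ne (fun h => by simp [h] at hj) _
        simp [contraction, h3, h4]
    have hB : ∀ φ, evalChain (faceSum φ) c' = evalChain φ (symmChain c) := fun φ =>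
      evalChain_faceSum_sweep_contraction q hN hcyc φ
    refine ⟨c', hL, hS, ?_, ?_, ?_⟩
    · intro l hl x hx y hy
      refine (dist_of_mem_sweep_contraction hqn hnorm hdist' hl hx hy).trans (le_of_eq ?_)
      push_cast; ring
    · intro φ
      have : ∀ l : List (Fin n → ℝ), faceSum φ (l.map Neg.neg) =
          faceSum (fun t => φ (t.map Neg.neg)) l := fun l => faceSum_map φ _ l
      rw [evalChain_symmChain, evalChain_add]
      simp only [this]
      rw [hB, hB, evalChain_symmChain_comp_neg, zmod_two_add_self]
    -- On the cone and its antipode together, the new cup product equals the coboundary of the old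
    -- one on the cone, that is, the old one on the boundary sphere.
    · rw [evalChain_symmChain]
      have : ∀ l ∈ c', cupCochain ε (d + 1) l + cupCochain ε (d + 1) (l.map Neg.neg)
          = faceSum (cupCochain ε d) l := by
        intro l hl
        rw [faceSum_cupCochain ε d l (hL l hl),
          cupCochain_add_map_neg ε (d + 1) (by intro h; simpa [h] using hL l hl)
            fun i hi x hx => hε i (by omega) x (hS l hl x hx).1]
      rw [evalChain_congr this, hB, hval]

/-- A form of the Borsuk-Ulam theorem for symmetric neighbourhoods of the origin: if the ball of
`ℝ^(p+1)` is separated by a symmetric set which is covered by `p` pairs of antipodal disjoint open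
sets, then the sphere and the origin lie on the same side. -/
theorem borsuk_ulam_separation {p : ℕ} (W : ℕ → Set (Fin (p + 1) → ℝ))
    (e : (Fin (p + 1) → ℝ) → ℝ) (hW : ∀ i < p, IsOpen (W i))
    (hWneg : ∀ i < p, ∀ x, l1 x ≤ 1 → x ∈ W i → -x ∉ W i)
    (he : Continuous e) (heven : ∀ x, e (-x) = e x)
    (hcover : ∀ x, l1 x ≤ 1 → e x = 0 → ∃ i < p, x ∈ W i ∨ -x ∈ W i)
    (h0 : e 0 < 0) (h1 : ∀ x, l1 x = 1 → 0 < e x) : False := by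
  classical
  obtain ⟨s, hs⟩ : ∃ s : (Fin (p + 1) → ℝ) → ZMod 2, ∀ x, x ≠ 0 → s x + s (-x) = 1 := by
    refine ⟨fun x => if WellOrderingRel x (-x) then 1 else 0, fun x hx => ?_⟩
    have hne : x ≠ -x := fun h => hx (self_eq_neg.1 h)
    rcases trichotomous_of WellOrderingRel x (-x) with h | h | h
    · have h' : ¬ WellOrderingRel (-x) x := asymm_of _ h
      simp [h, h']
    · exact absurd h hne
    · have h' : ¬ WellOrderingRel x (-x) := asymm_of _ h
      simp [h, h']
  -- For i < p these are odd away from 0 in the ball and constant on `W i` and on its antipode. The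
  -- last one is constant on {e < 0} and odd on {e > 0}, hence all are odd on the sphere. No
  -- continuity is needed, so an arbitrary choice of signs s serves elsewhere.
  set ε : ℕ → (Fin (p + 1) → ℝ) → ZMod 2 := fun i x =>
    if i < p then (if x ∈ W i then 1 else if -x ∈ W i then 0 else s x)
    else (if e x < 0 then 0 else s x) with hεdef
  have ne_zero_of_e : ∀ x, ¬ e x < 0 → x ≠ 0 := by rintro x hx rfl; exact hx h0
  have hodd_lt : ∀ i < p, ∀ x, x ≠ 0 → l1 x ≤ 1 → ε i x + ε i (-x) = 1 := by
    intro i hi x hx hx1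
    have h2 := hWneg i hi x hx1
    have h3 := hWneg i hi (-x) (by rwa [l1_neg])
    simp only [hεdef, hi, if_true, neg_neg] at h3 ⊢
    by_cases ha : x ∈ W i
    · simp [ha, h2 ha]
    · by_cases hb : -x ∈ W i
      · simp [ha, hb]
      · simp [ha, hb, hs x hx]
  have hodd_e : ∀ i < p + 1, ∀ x, l1 x ≤ 1 → 0 < e x → ε i x + ε i (-x) = 1 := by
    intro i hi x hx hex
    have hx0 := ne_zero_of_e x hex.not_gt
    by_cases hip : i < p
    · exact hodd_lt i hip x hx0 hx
    · simp [hεdef, hip, heven, hex.not_gt, hs x hx0]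
  -- a Lebesgue number of the cover
  let U : Bool ⊕ Bool × Fin p → Set (Fin (p + 1) → ℝ) := fun o =>
    match o with
    | Sum.inl true => {x | 0 < e x}
    | Sum.inl false => {x | e x < 0}
    | Sum.inr (true, i) => W i
    | Sum.inr (false, i) => Neg.neg ⁻¹' W i
  have hU : ∀ o, IsOpen (U o) := by
    rintro (⟨(_ | _)⟩ | ⟨(_ | _), i⟩)
    · exact isOpen_lt he continuous_const
    · exact isOpen_lt continuous_const he
    · exact (hW i i.2).preimage continuous_neg
    · exact hW i i.2
  have hcov : {x : Fin (p + 1) → ℝ | l1 x ≤ 1} ⊆ ⋃ o, U o := by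
    intro x hx
    rw [Set.mem_iUnion]
    rcases lt_trichotomy (e x) 0 with h | h | h
    · exact ⟨Sum.inl false, h⟩
    · obtain ⟨i, hi, h | h⟩ := hcover x hx h
      · exact ⟨Sum.inr (true, ⟨i, hi⟩), h⟩
      · exact ⟨Sum.inr (false, ⟨i, hi⟩), h⟩
    · exact ⟨Sum.inl true, h⟩
  obtain ⟨δ, hδ, hLeb⟩ := lebesgue_number_lemma_of_metric (isCompact_l1_le 1) hU hcov
  -- Tuples in the contracted cycle have diameter at most p · 2/N + 2/N.
  obtain ⟨N, hN⟩ := exists_nat_gt (2 * (p + 1) / δ)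
  have hNpos : 0 < N := by
    have : (0 : ℝ) < N := lt_of_le_of_lt (by positivity) hN
    exact_mod_cast this
  obtain ⟨c, hlen, hsph, hdist, hcyc, hval⟩ := exists_chain_l1_sphere ε
    (fun i hi x hx => hodd_e i hi x hx.le (h1 x hx)) hNpos p (Nat.lt_succ_self p)
  set b := sweep (contraction (0 : Fin (p + 1) → ℝ) N) N c with hb
  set B := sweep (contraction (0 : Fin (p + 1) → ℝ) N) N (symmChain c) with hB
  have hlen' : ∀ l ∈ symmChain c, l.length = p + 1 :=
    forall_mem_symmChain hlen fun l hl => by simpa using hl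
  have hval' : evalChain (faceSum (cupCochain ε p)) B = 1 := by
    rw [hB, evalChain_faceSum_sweep_contraction 0 hNpos hcyc, hval]
  have hface : evalChain (faceSum (cupCochain ε p)) B = evalChain (edgeProd ε (p + 1)) B :=
    evalChain_congr fun l hl => faceSum_cupCochain ε p l (length_of_mem_sweep hlen' hl)
  have hnegprism : ∀ (k : ℕ) (l : List (Fin (p + 1) → ℝ)),
      prism (contraction 0 N k) (contraction 0 N (k + 1)) (l.map Neg.neg)
        = (prism (contraction (0 : Fin (p + 1) → ℝ) N k) (contraction 0 N (k + 1)) l).map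
          (List.map Neg.neg) := by
    intro k l
    have hc : ∀ k (x : Fin (p + 1) → ℝ), contraction 0 N k (-x) = -contraction 0 N k x := by
      intro k x; simp only [contraction]; module
    induction l with
    | nil => rfl
    | cons v l ih =>
      simp [prism, ih, hc, Function.comp_def]
  have hsplit : evalChain (edgeProd ε (p + 1)) B
      = evalChain (fun l => edgeProd ε (p + 1) l + edgeProd ε (p + 1) (l.map Neg.neg)) b := by
    rw [hB, hb, sweep, sweep, evalChain_flatMap, evalChain_flatMap]
    refine congrArg (fun f => (List.map f (List.range N)).sum) (funext fun k => ?_)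
    rw [evalChain_flatMap, evalChain_flatMap]
    change evalChain (fun l => evalChain _ (prism _ _ l)) (symmChain c) = _
    rw [evalChain_symmChain]
    refine congrArg (fun f => (List.map f c).sum) (funext fun l => ?_)
    rw [hnegprism, evalChain_map, evalChain_add]
  have hzero : evalChain (fun l => edgeProd ε (p + 1) l + edgeProd ε (p + 1) (l.map Neg.neg)) b
      = 0 := by
    refine evalChain_eq_zero fun t ht => ?_
    have hball : ∀ x ∈ t, l1 x ≤ 1 := by
      intro x hx
      obtain ⟨l, hl, v, hv, k, hk, rfl⟩ := exists_of_mem_sweep_contraction ht hx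
      have h0 : (0 : ℝ) ≤ k / N := by positivity
      have h1 : (k / N : ℝ) ≤ 1 := div_le_one_of_le₀ (by exact_mod_cast hk) (by positivity)
      have : contraction 0 N k v = (1 - (k / N : ℝ)) • v := by simp only [contraction]; module
      rw [this, l1_smul, (hsph l hl v hv).1, abs_of_nonneg (by linarith)]
      linarith
    have hsmall : ∀ x ∈ t, ∀ y ∈ t, ‖x - y‖ < δ := by
      intro x hx y hy
      have h2 := dist_of_mem_sweep_contraction (q := (0 : Fin (p + 1) → ℝ)) (by simp)
        (fun l hl x hx => (norm_le_l1 x).trans (hsph l hl x hx).1.le) hdist ht hx hy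
      refine h2.trans_lt ?_
      rw [div_lt_iff₀ hδ] at hN
      have hN' : (0 : ℝ) < N := by exact_mod_cast hNpos
      have : (p * (2 / N) + 2 / N : ℝ) = 2 * (p + 1) / N := by ring
      rw [this, div_lt_iff₀ hN']
      linarith
    have hlt : t.length = p + 1 + 1 := length_of_mem_sweep hlen ht
    obtain ⟨x, l, rfl⟩ := List.exists_cons_of_length_eq_add_one hlt
    obtain ⟨o, ho⟩ := hLeb x (hball x (by simp))
    have hmem : ∀ y ∈ x :: l, y ∈ U o := fun y hy => ho (by
      rw [Metric.mem_ball, dist_eq_norm]; exact hsmall y hy x (by simp))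
    have zero_of : ∀ i < p + 1, (∀ y ∈ x :: l, ∀ z ∈ x :: l, ε i y = ε i z) →
        (∀ y ∈ x :: l, ∀ z ∈ x :: l, ε i (-y) = ε i (-z)) →
        edgeProd ε (p + 1) (x :: l) + edgeProd ε (p + 1) ((x :: l).map Neg.neg) = 0 := by
      intro i hi ha hb
      rw [edgeProd_eq_zero ε hi ha, edgeProd_eq_zero ε hi, add_zero]
      intro _ hy _ hz
      obtain ⟨u, hu, rfl⟩ := List.mem_map.1 hy
      obtain ⟨v, hv, rfl⟩ := List.mem_map.1 hz
      exact hb u hu v hv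
    -- On {e > 0} the product of coboundaries is even, so antipodal terms cancel. In the other cases
    -- one cochain is constant on the tuple and on its antipode, killing a factor. The filling thus
    -- has value 0, while its boundary has value 1.
    match o, hmem with
    | Sum.inl true, hmem =>
      rw [edgeProd_map_neg ε (p + 1) fun i hi y hy => hodd_e i hi y (hball y hy) (hmem y hy)]
      exact zmod_two_add_self _
    | Sum.inl false, hmem =>
      have hv : ∀ y ∈ x :: l, e y < 0 := hmem
      refine zero_of p (Nat.lt_succ_self p) (fun y hy z hz => ?_) fun y hy z hz => ?_
      · simp [hεdef, hv y hy, hv z hz]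
      · simp [hεdef, heven, hv y hy, hv z hz]
    | Sum.inr (true, i), hmem =>
      have hv : ∀ y ∈ x :: l, y ∈ W i := hmem
      have hv' : ∀ y ∈ x :: l, -y ∉ W i := fun y hy => hWneg i i.2 y (hball y hy) (hv y hy)
      refine zero_of i (i.2.trans (Nat.lt_succ_self p)) (fun y hy z hz => ?_) fun y hy z hz => ?_
      · simp [hεdef, hv y hy, hv z hz]
      · simp [hεdef, hv y hy, hv z hz, hv' y hy, hv' z hz]
    | Sum.inr (false, i), hmem =>
      have hv : ∀ y ∈ x :: l, -y ∈ W i := hmem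
      have hv' : ∀ y ∈ x :: l, y ∉ W i := fun y hy hyW => hWneg i i.2 y (hball y hy) hyW (hv y hy)
      refine zero_of i (i.2.trans (Nat.lt_succ_self p)) (fun y hy z hz => ?_) fun y hy z hz => ?_
      · simp [hεdef, hv y hy, hv z hz, hv' y hy, hv' z hz]
      · simp [hεdef, hv y hy, hv z hz]
  rw [hface, hsplit, hzero] at hval'
  exact zero_ne_one hval'

end Sphere

/-! ### The condition (M) and the mountain pass level -/

section Cerami

variable {H Y : Type*} [NormedAddCommGroup H] [InnerProductSpace ℝ H] [CompleteSpace H]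
  [NormedAddCommGroup Y] [NormedSpace ℝ Y] {G : Type*} [Group G] [MulAction G (Space H Y)]
  {I : Space H Y → ℝ} {r : ℝ}

lemma isCeramiBetween_of_tendsto {α β : ℝ} {u : ℕ → H} (hα : ∀ n, α ≤ reduced I (u n))
    (hβ : ∀ n, reduced I (u n) ≤ β)
    (h : Tendsto (fun n => weightedSlope (reduced I) (u n)) atTop (𝓝 0)) :
    IsCeramiBetween I α β u := by
  refine ⟨?_, ?_, ?_⟩
  · exact le_liminf_of_le (h := Eventually.of_forall fun n => EReal.coe_le_coe_iff.2 (hα n))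
  · exact limsup_le_of_le (h := Eventually.of_forall fun n => EReal.coe_le_coe_iff.2 (hβ n))
  · rw [tendsto_zero_iff_norm_tendsto_zero]
    refine h.congr fun n => ?_
    rw [norm_smul, Real.norm_of_nonneg (by positivity), weightedSlope]

lemma tendsto_zero_of_lt_one_div {f : ℕ → ℝ} (h0 : ∀ n, 0 ≤ f n)
    (h : ∀ n : ℕ, f n < 1 / ((n : ℝ) + 1)) : Tendsto f atTop (𝓝 0) :=
  squeeze_zero h0 (fun n => (h n).le) tendsto_one_div_add_atTop_nhds_zero_nat

/-- Failure of a uniform bound produces Cerami sequences with slopes below 1/(n+1), which (M)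
excludes. The added 1 in the radius turns the limsup bound into a strict contradiction. -/
lemma ConditionM.exists_hasDiscreteAlmostCritical {β : ℝ} (hM : ConditionM G I 0 β)
    (hfin : (reducedCriticalOrbits G I 0 β).Finite) :
    ∃ m M, HasDiscreteAlmostCritical (reduced I) β m M := by
  obtain ⟨M, hMb⟩ := hM.bounded
  obtain ⟨m, hm, hmd⟩ := hM.discrete hfin
  refine ⟨m, max M 0 + 1, hm, by positivity, ?_, ?_⟩
  · by_contra! hcon
    choose u h0 hβ hs hu using fun n : ℕ => hcon (1 / ((n : ℝ) + 1)) (by positivity)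
    have hC := hMb u (isCeramiBetween_of_tendsto h0 hβ
      (tendsto_zero_of_lt_one_div (fun n => weightedSlope_nonneg _ _) hs))
    have h1 : ((M + 1 : ℝ) : EReal) ≤ liminf (fun n => (‖u n‖ : EReal)) atTop :=
      le_liminf_of_le (h := Eventually.of_forall fun n => EReal.coe_le_coe_iff.2 (by
        have := hu n
        have := le_max_left M 0
        linarith))
    have h2 := EReal.coe_le_coe_iff.1 ((h1.trans (liminf_le_limsup)).trans hC)
    linarith
  · by_contra! hcon
    obtain ⟨ρ, hρ, hcon⟩ := hcon
    choose u v hu0 huβ hv0 hvβ hus hvs hlt hge using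
      fun n : ℕ => hcon (1 / ((n : ℝ) + 1)) (by positivity)
    have hC := hmd u v
      (isCeramiBetween_of_tendsto hu0 huβ
        (tendsto_zero_of_lt_one_div (fun n => weightedSlope_nonneg _ _) hus))
      (isCeramiBetween_of_tendsto hv0 hvβ
        (tendsto_zero_of_lt_one_div (fun n => weightedSlope_nonneg _ _) hvs))
      (Eventually.of_forall hlt)
    have h1 : ((ρ : ℝ) : EReal) ≤ liminf (fun n => (‖u n - v n‖ : EReal)) atTop :=
      le_liminf_of_le (h := Eventually.of_forall fun n => EReal.coe_le_coe_iff.2 (hge n))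
    rw [hC] at h1
    have h2 : ρ ≤ 0 := EReal.coe_le_coe_iff.1 h1
    linarith

/-- On a compact set the descent below a level takes a uniform number of steps. -/
lemma IsDescentStep.exists_uniform_iterate {Φ ψ : H → ℝ} {s : ℝ} {F : H → H} {σ : H → ℝ}
    (hF : IsDescentStep Φ ψ s F σ) (hΦ : Continuous Φ) (hψ0 : ∀ u, 0 ≤ ψ u) {a : ℝ} {K : Set H}
    (hK : IsCompact K) (h : ∀ u ∈ K, ∃ n, Φ (F^[n] u) < a) : ∃ N, ∀ u ∈ K, Φ (F^[N] u) < a := by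
  obtain ⟨N, hN⟩ := hK.elim_directed_cover (fun n => {u | Φ (F^[n] u) < a})
    (fun n => isOpen_lt (hΦ.comp (hF.continuous.iterate n)) continuous_const)
    (fun u hu => Set.mem_iUnion.2 (h u hu))
    (directed_of_isDirected_le fun i j hij u hu =>
      lt_of_le_of_lt (hF.iterate_antitone hψ0 u hij) hu)
  exact ⟨N, hN⟩

/-- Existence of a critical point at the level `c_ℳ`, or of critical values accumulating there. -/
theorem Conditions.exists_isCritical_or_tendsto [Nontrivial H] (hI : Conditions I r)
    (hrefl : IsReflexive (Space H Y))
    (hM : ∀ ε₀ : ℝ, 0 < ε₀ → ∃ ε : ℝ, 0 < ε ∧ ε ≤ ε₀ ∧ ConditionM G I 0 (levelM I r + ε)) :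
    (∃ u, IsCritical I u ∧ functional I u = levelM I r) ∨
      (∃ c : ℕ → ℝ, (∀ n, IsCriticalValue I (c n) ∧ levelM I r < c n) ∧
        Tendsto c atTop (𝓝 (levelM I r))) := by
  by_contra! hcon
  obtain ⟨hne, hseq⟩ := hcon
  set c := levelM I r with hc
  have hcpos : 0 < c := hI.levelM_pos hrefl
  obtain ⟨ε₀, hε₀, hgapvals⟩ : ∃ ε₀ : ℝ, 0 < ε₀ ∧
      ∀ w, IsCritical I w → c < functional I w → c + ε₀ < functional I w := by
    by_contra! h
    choose w hw hlt hle using fun n : ℕ => h (1 / ((n : ℝ) + 1)) (by positivity)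
    refine hseq (fun n => functional I (w n)) (fun n => ⟨⟨w n, hw n, rfl⟩, hlt n⟩) ?_
    refine tendsto_of_tendsto_of_tendsto_of_le_of_le tendsto_const_nhds ?_ (fun n => (hlt n).le) hle
    simpa using tendsto_const_nhds.add (tendsto_one_div_add_atTop_nhds_zero_nat (𝕜 := ℝ))
  obtain ⟨ε, hε, hεle, hMε⟩ := hM ε₀ hε₀
  have hcritlevel : ∀ u : H, fderiv ℝ (reduced I) u = 0 → u ≠ 0 → c + ε < reduced I u := by
    intro u hu hu0
    have hcr := (hI.isCritical_mapM_iff hrefl u).2 hu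
    have hm0 : mapM I u ≠ 0 := fun h => hu0 (congrArg (fun w : Space H Y => w.fst) h)
    have h1 : c ≤ reduced I u := hI.levelM_le_of_isCritical hrefl hcr hm0
    have h2 : c < reduced I u := lt_of_le_of_ne h1 fun h => hne _ hcr h.symm
    exact lt_of_le_of_lt (by linarith) (hgapvals _ hcr h2)
  have hfin : (reducedCriticalOrbits G I 0 (c + ε)).Finite := by
    refine (Set.finite_singleton (MulAction.orbit G (pair 0 0 : Space H Y))).subset ?_
    rintro O ⟨u, hu, -, hle, rfl⟩
    rcases eq_or_ne u 0 with rfl | hu0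
    · rfl
    · exact absurd (hcritlevel u hu hu0) (not_lt.2 hle)
  obtain ⟨m, M, hgap⟩ := hMε.exists_hasDiscreteAlmostCritical hfin
  have hm := hgap.pos
  have hM0 := hgap.nonneg
  have hd := hI.differentiable_reduced hrefl
  -- All critical points other than 0 lie above c + ε, so the exceptional set O is never met from
  -- below. Levels up to c/3, including both path ends, stay fixed.
  obtain ⟨ψ, F, σ, hF, hψ0, -, -, hfix, hdesc, -⟩ := exists_descent_map
    (s := m / 4 / (1 + M + m)) (a := c / 3) (a' := c / 2) (O := {u | c + ε < reduced I u})
    hd (hI.continuous_fderiv_reduced hrefl) hgap (by positivity) (by linarith)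
    (by positivity) (by field_simp; rfl) (isOpen_lt continuous_const hd.continuous)
    (fun u hu hle => hcritlevel u hu (by
      rintro rfl
      rw [hI.reduced_zero hrefl] at hle
      linarith))
  have := hI.nonempty_pathsM hrefl
  obtain ⟨γ, hγ⟩ : ∃ γ : pathsM I r, (⨆ t : unitInterval, functional I (γ.1 t)) < c + ε :=
    exists_lt_of_ciInf_lt (by rw [← levelM]; linarith)
  obtain ⟨hγM, hγ0, hγr, hγ1⟩ := γ.2
  have hred : ∀ t, reduced I (γ.1 t).fst = functional I (γ.1 t) := fun t => by
    rw [reduced, hI.mapM_fst_of_mem hrefl (hγM t)]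
  have hσ : Continuous fun t => (γ.1 t).fst := continuous_fst_space.comp γ.1.2
  have hlow : ∀ t, reduced I (γ.1 t).fst ≤ c + ε := fun t => by
    rw [hred]
    exact (hI.functional_le_iSup γ.1 t).trans hγ.le
  obtain ⟨N, hN⟩ := hF.exists_uniform_iterate hd.continuous hψ0 (isCompact_range hσ) (a := c / 2) (by
    rintro _ ⟨t, rfl⟩
    obtain ⟨n, h | h⟩ := hdesc _ (hlow t)
    · exact ⟨n, h⟩
    · have h1 := (hF.iterate_antitone hψ0 (γ.1 t).fst (Nat.zero_le n)).trans (hlow t)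
      exact absurd h (not_lt.2 h1))
  have hfixN : ∀ u, reduced I u ≤ c / 3 → F^[N] u = u := fun u hu =>
    Function.iterate_fixed (hfix u hu) N
  have e0 : (γ.1 0).fst = 0 := by rw [hγ0]; rfl
  have e1 : F^[N] (γ.1 1).fst = (γ.1 1).fst := hfixN _ (by rw [hred]; linarith)
  have hfinal : c ≤ c / 2 := by
    refine hI.levelM_le_of_path hrefl
      ⟨fun t => F^[N] (γ.1 t).fst, (hF.continuous.iterate N).comp hσ⟩ ?_ ?_ ?_
      fun t => (hN _ ⟨t, rfl⟩).le
    · change F^[N] (γ.1 0).fst = 0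
      rw [e0]
      exact hfixN 0 (by rw [hI.reduced_zero hrefl]; positivity)
    · change r < ‖F^[N] (γ.1 1).fst‖
      rw [e1]
      exact hγr
    · change reduced I (F^[N] (γ.1 1).fst) < 0
      rw [e1, hred]
      exact hγ1
  linarith

end Cerami

/-! ### Critical orbits of 𝒥 and of 𝒥̃ -/

section Orbits

variable {H Y : Type*} [NormedAddCommGroup H] [InnerProductSpace ℝ H]
  [NormedAddCommGroup Y] [NormedSpace ℝ Y] {G : Type*} [Group G] [MulAction G (Space H Y)]
  {I : Space H Y → ℝ} {r : ℝ}

/-- An isometric action which leaves the summands invariant is linear, so it commutes with the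
projection onto `X⁺`. -/
lemma ActsDiscretely.smul_pair_fst (hG : ActsDiscretely G I) (g : G) (w : Space H Y) :
    g • (pair w.fst 0 : Space H Y) = pair (g • w).fst 0 := by
  have hzero : g • (0 : Space H Y) = 0 := by
    have h1 : (g • (0 : Space H Y)).fst = 0 := hG.invariant_tilde g 0 rfl
    have h2 : (g • (0 : Space H Y)).snd = 0 := hG.invariant_plus g 0 rfl
    rw [← pair_fst_snd (g • (0 : Space H Y)), h1, h2]
    rfl
  let e : Space H Y ≃ᵢ Space H Y := ⟨MulAction.toPerm g, hG.isometry g⟩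
  -- Mazur–Ulam: 0 is fixed because it spans the intersection of the two invariant summands.
  let L := e.toRealLinearIsometryEquivOfMapZero hzero
  have hadd : g • w = g • (pair w.fst 0 : Space H Y) + g • (pair 0 w.snd : Space H Y) := by
    have h := L.map_add (pair w.fst 0) (pair 0 w.snd)
    rw [pair_add, add_zero, zero_add, pair_fst_snd] at h
    exact h
  have h1 : (g • (pair w.fst 0 : Space H Y)).snd = 0 := hG.invariant_plus g _ rfl
  have h2 : (g • (pair 0 w.snd : Space H Y)).fst = 0 := hG.invariant_tilde g _ rfl
  have h3 : (g • w).fst = (g • (pair w.fst 0 : Space H Y)).fst := by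
    rw [hadd, WithLp.add_fst, h2, add_zero]
  rw [h3]
  conv_lhs => rw [← pair_fst_snd (g • (pair w.fst 0 : Space H Y)), h1]

/-- The projection to X⁺ is equivariant, so it maps the orbit of m(u) onto that of u. -/
lemma ActsDiscretely.finite_reducedCriticalOrbits (hG : ActsDiscretely G I) (hI : Conditions I r)
    (hrefl : IsReflexive (Space H Y)) (hfin : (criticalOrbits G I).Finite) (α β : ℝ) :
    (reducedCriticalOrbits G I α β).Finite := by
  refine (hfin.image (Set.image fun w : Space H Y => (pair w.fst 0 : Space H Y))).subset ?_
  rintro O ⟨u, hu, -, -, rfl⟩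
  refine ⟨_, ⟨mapM I u, (hI.isCritical_mapM_iff hrefl u).2 hu, rfl⟩, ?_⟩
  ext w
  constructor
  · rintro ⟨_, ⟨g, rfl⟩, rfl⟩
    exact ⟨g, hG.smul_pair_fst g (mapM I u)⟩
  · rintro ⟨g, rfl⟩
    exact ⟨g • mapM I u, ⟨g, rfl⟩, (hG.smul_pair_fst g (mapM I u)).symm⟩

lemma ActsDiscretely.finite_criticalValues (hG : ActsDiscretely G I)
    (hfin : (criticalOrbits G I).Finite) : {c | IsCriticalValue I c}.Finite := by
  classical
  refine (hfin.image fun O : Set (Space H Y) =>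
    if h : ∃ u, u ∈ O then functional I h.choose else 0).subset ?_
  rintro c ⟨u, hu, rfl⟩
  refine ⟨_, ⟨u, hu, rfl⟩, ?_⟩
  have hex : ∃ v, v ∈ MulAction.orbit G u := ⟨u, MulAction.mem_orbit_self u⟩
  simp only [dif_pos hex]
  obtain ⟨g, hg⟩ := hex.choose_spec
  rw [← hg]
  exact hG.invariant g u

end Orbits

/-! ### Infinitely many critical values for even functionals -/

section Multiplicity

variable {H : Type*} [NormedAddCommGroup H] [InnerProductSpace ℝ H] [CompleteSpace H]
  {Φ ψ : H → ℝ} {F : H → H} {σ : H → ℝ} {s β m M : ℝ}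

lemma HasDiscreteAlmostCritical.le_norm_sub (h : HasDiscreteAlmostCritical Φ β m M) {z y : H}
    (hz : fderiv ℝ Φ z = 0) (hy : fderiv ℝ Φ y = 0) (hz0 : 0 ≤ Φ z) (hzβ : Φ z ≤ β)
    (hy0 : 0 ≤ Φ y) (hyβ : Φ y ≤ β) (hne : z ≠ y) : m ≤ ‖z - y‖ := by
  by_contra hlt
  obtain ⟨δ, hδ, hg⟩ := h.gap ‖z - y‖ (norm_pos_iff.2 (sub_ne_zero.2 hne))
  exact lt_irrefl _ (hg z y hz0 hzβ hy0 hyβ (by rwa [weightedSlope_eq_zero_iff.2 hz])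
    (by rwa [weightedSlope_eq_zero_iff.2 hy]) (not_le.1 hlt))

/-- A trajectory of the descent cannot visit small neighbourhoods of two critical points of the
same level while its own level is close to theirs. -/
lemma IsDescentStep.not_visits_two (hF : IsDescentStep Φ ψ s F σ) (hψ0 : ∀ u, 0 ≤ ψ u)
    (hψ1 : ∀ u, ψ u ≤ 1) (hgap : HasDiscreteAlmostCritical Φ β m M)
    (hs : s * (1 + M + m) ≤ m / 4) {δ κ a : ℝ} (hδ : 0 < δ)
    (hgapδ : ∀ u v, 0 ≤ Φ u → Φ u ≤ β → 0 ≤ Φ v → Φ v ≤ β →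
      weightedSlope Φ u < δ → weightedSlope Φ v < δ → ‖u - v‖ < m → ‖u - v‖ < m / 8)
    (hκ : κ ≤ δ * (m / 8) / (2 * (1 + M + m))) (ha : 0 ≤ a)
    (hcβ : ∀ z, fderiv ℝ Φ z = 0 → Φ z ≤ β) {O : Set H}
    (hO : ∀ u ∈ O, ∃ z, fderiv ℝ Φ z = 0 ∧ 0 < Φ z ∧ ‖u - z‖ < m / 8)
    (hψ : ∀ u, a ≤ Φ u → u ∉ O → ψ u = 1) {u z y : H} (hu : Φ u ≤ β)
    (hz : fderiv ℝ Φ z = 0) (hy : fderiv ℝ Φ y = 0) (hzy : Φ z = Φ y) (hne : z ≠ y)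
    (hya : 0 < Φ y) (hyκ : a ≤ Φ y - κ / 2)
    {i j : ℕ} (hij : i ≤ j) (hi : ‖F^[i] u - z‖ < m / 8) (hi' : |Φ (F^[i] u) - Φ z| < κ / 2)
    (hj : ‖F^[j] u - y‖ < m / 8) (hj' : |Φ (F^[j] u) - Φ y| < κ / 2) : False := by
  have hm := hgap.pos
  have hM := hgap.nonneg
  have hsucc : ∀ n, F^[n + 1] u = F (F^[n] u) := fun n => Function.iterate_succ_apply' F n u
  have hmono := hF.iterate_antitone hψ0 u
  have hsep := hgap.le_norm_sub hz hy (hzy ▸ hya.le) (hcβ z hz) hya.le (hcβ y hy) hne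
  have hzM : ‖z‖ ≤ M := by
    obtain ⟨δ', hδ', hb⟩ := hgap.bounded
    exact hb z (hzy ▸ hya.le) (hcβ z hz) (by rwa [weightedSlope_eq_zero_iff.2 hz])
  -- Distinct critical points are at least m apart, so reaching y forces the trajectory through the
  -- annulus m/8 ≤ ‖· - z‖ < m/2. Points there are far from all critical points in question, hence
  -- outside O and of slope at least δ. The crossing costs at least κ, more than the levels near z
  -- and y allow.
  have hjz : m / 2 ≤ ‖F^[j] u - z‖ := by
    have h1 : z - y = (F^[j] u - y) - (F^[j] u - z) := by abel
    have h2 := _root_.norm_sub_le (F^[j] u - y) (F^[j] u - z)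
    rw [← h1] at h2
    linarith
  have henergy := energy_le_of_crossing (u := fun n => F^[n] u) (φ := fun n => Φ (F^[n] u))
    (s := fun n => σ (F^[n] u)) (z := z) (ρ := m / 8) (R := m / 2) (L := 1 + M + m) (δ := δ)
    (s₀ := s) hδ.le (fun n => (hF.size_pos _).le) (fun n => hF.size_le _) (by linarith)
    (by positivity) (fun n => ?_) (fun n => hmono (Nat.le_succ n)) hij
    (fun k _ hkj h1 h2 => ?_) hi hjz
  · have h1 : κ ≤ δ * (m / 2 - m / 8 - s * (1 + M + m)) / (2 * (1 + M + m)) := by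
      refine hκ.trans ?_
      gcongr
      linarith
    have h2 := (abs_lt.1 hi').2
    have h3 := (abs_lt.1 hj').1
    linarith
  · rw [hsucc]
    refine (hF.norm_sub_le _).trans ?_
    have := mul_le_of_le_one_right (hF.size_pos (F^[n] u)).le (hψ1 (F^[n] u))
    gcongr
  · have hka : a ≤ Φ (F^[k] u) := by
      have h3 : Φ (F^[j] u) ≤ Φ (F^[k] u) := hmono hkj.le
      have h4 := (abs_lt.1 hj').1
      linarith
    have hkβ : Φ (F^[k] u) ≤ β := (hmono (Nat.zero_le k)).trans hu
    have hkO : F^[k] u ∉ O := by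
      intro hmem
      obtain ⟨x, hx, hx0, hxk⟩ := hO _ hmem
      rcases eq_or_ne z x with rfl | hzx
      · exact absurd hxk (not_lt.2 h1)
      · have h3 := hgap.le_norm_sub hz hx (hzy ▸ hya.le) (hcβ z hz) hx0.le (hcβ x hx) hzx
        have h4 : z - x = (F^[k] u - x) - (F^[k] u - z) := by abel
        have h5 := _root_.norm_sub_le (F^[k] u - x) (F^[k] u - z)
        rw [← h4] at h5
        linarith
    have hslope : δ ≤ weightedSlope Φ (F^[k] u) := by
      by_contra h
      exact absurd (hgapδ _ z (ha.trans hka) hkβ (hzy ▸ hya.le) (hcβ z hz) (not_le.1 h)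
        (by rwa [weightedSlope_eq_zero_iff.2 hz]) (by linarith)) (not_lt.2 h1)
    have h3 := hF.decrease (F^[k] u)
    rw [hψ _ hka hkO, mul_one] at h3
    rw [hsucc]
    have h4 := mul_le_mul_of_nonneg_left hslope (hF.size_pos (F^[k] u)).le
    linarith

/-- An even functional with the geometry of the symmetric mountain pass theorem, whose almost
critical points are discrete, cannot have finitely many critical values. -/
theorem infinite_criticalValues_of_even (hd : Differentiable ℝ Φ) (hc : Continuous (fderiv ℝ Φ))
    (heven : ∀ u, Φ (-u) = Φ u) (h0 : Φ 0 = 0) {r a₀ : ℝ} (hr : 0 < r) (ha₀ : 0 < a₀)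
    (hsphere : ∀ u, ‖u‖ = r → a₀ ≤ Φ u)
    (hneg : ∀ Q : Set H, IsCompact Q → (0 : H) ∉ Q → ∃ R : ℝ, ∀ t : ℝ, R ≤ t →
      ∀ w ∈ Q, Φ (t • w) < 0)
    (hcrit : ∀ u, fderiv ℝ Φ u = 0 → u ≠ 0 → a₀ ≤ Φ u)
    (hgap : ∀ β, 0 < β → ∃ m M, HasDiscreteAlmostCritical Φ β m M)
    (hdim : ¬ FiniteDimensional ℝ H) : {c | ∃ u, fderiv ℝ Φ u = 0 ∧ Φ u = c}.Infinite := by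
  classical
  intro hfin
  obtain ⟨p, cv, hcv⟩ : ∃ (p : ℕ) (cv : ℕ → ℝ), ∀ u, fderiv ℝ Φ u = 0 → ∃ i < p, cv i = Φ u := by
    refine ⟨hfin.toFinset.toList.length, fun i => hfin.toFinset.toList.getD i 0, fun u hu => ?_⟩
    have hmem : Φ u ∈ hfin.toFinset.toList := by
      rw [Finset.mem_toList, Set.Finite.mem_toFinset]
      exact ⟨u, hu, rfl⟩
    obtain ⟨i, hi, hget⟩ := List.getElem_of_mem hmem
    exact ⟨i, hi, by rw [← hget]; exact List.getD_eq_getElem _ _ hi⟩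
  obtain ⟨ι, hι⟩ : ∃ ι : (Fin (p + 1) → ℝ) →ₗ[ℝ] H, Function.Injective ι := by
    rw [← Module.le_rank_iff_exists_linearMap]
    rw [FiniteDimensional, ← Module.rank_lt_aleph0_iff, not_lt] at hdim
    exact Cardinal.natCast_le_aleph0.trans hdim
  have hιc : Continuous ι := ι.continuous_of_finiteDimensional
  have hS : IsCompact {x : Fin (p + 1) → ℝ | l1 x = 1} :=
    (isCompact_l1_le 1).of_isClosed_subset (isClosed_eq continuous_l1 continuous_const)
      fun x hx => le_of_eq hx
  have hS0 : ∀ x : Fin (p + 1) → ℝ, l1 x = 1 → ι x ≠ 0 := by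
    intro x hx h
    rw [hι (h.trans ι.map_zero.symm), l1_zero] at hx
    exact zero_ne_one hx
  obtain ⟨R, hR⟩ := hneg (ι '' {x | l1 x = 1}) (hS.image hιc) (by
    rintro ⟨x, hx, h⟩
    exact hS0 x hx h)
  obtain ⟨μ, hμ, hμle⟩ := hS.exists_forall_le' (f := fun x => ‖ι x‖) (by fun_prop) (a := 0)
    fun x hx => norm_pos_iff.2 (hS0 x hx)
  -- Large enough that the image of the ℓ¹ sphere has negative energy and lies outside the ball of
  -- radius r.
  set T := max (max R 0) ((r + 1) / μ) with hT
  have hT0 : 0 ≤ T := (le_max_right R 0).trans (le_max_left _ _)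
  let j : (Fin (p + 1) → ℝ) → H := fun x => T • ι x
  have hj : Continuous j := by fun_prop
  have hjneg : ∀ x, j (-x) = -j x := fun x => by simp [j]
  have hj1 : ∀ x, l1 x = 1 → Φ (j x) < 0 := fun x hx =>
    hR T ((le_max_left R 0).trans (le_max_left _ _)) _ ⟨x, hx, rfl⟩
  have hjr : ∀ x, l1 x = 1 → r < ‖j x‖ := by
    intro x hx
    have h1 : (r + 1) / μ ≤ T := le_max_right _ _
    rw [div_le_iff₀ hμ] at h1
    have h2 : T * μ ≤ T * ‖ι x‖ := by gcongr; exact hμle x hx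
    change r < ‖T • ι x‖
    rw [norm_smul, Real.norm_of_nonneg hT0]
    linarith
  obtain ⟨b₁, hb₁⟩ := (((isCompact_l1_le 1).image hj).image hd.continuous).bddAbove
  obtain ⟨b₂, hb₂⟩ := hfin.bddAbove
  set β := max (max b₁ b₂) 1 with hβ
  have hjβ : ∀ x, l1 x ≤ 1 → Φ (j x) ≤ β := fun x hx =>
    (hb₁ ⟨_, ⟨x, hx, rfl⟩, rfl⟩).trans ((le_max_left _ _).trans (le_max_left _ _))
  have hcβ : ∀ z, fderiv ℝ Φ z = 0 → Φ z ≤ β := fun z hz =>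
    (hb₂ ⟨z, hz, rfl⟩).trans ((le_max_right _ _).trans (le_max_left _ _))
  obtain ⟨m, M, hg⟩ := hgap β (lt_of_lt_of_le one_pos (le_max_right _ _))
  have hm := hg.pos
  have hM := hg.nonneg
  obtain ⟨δ, hδ, hgδ⟩ := hg.gap (m / 8) (by positivity)
  -- At most the cost of the annulus in `IsDescentStep.not_visits_two`, and at most `a₀`, so that
  -- points near a positive critical level stay above `a₀ / 2`.
  set κ := min (δ * (m / 8) / (2 * (1 + M + m))) a₀ with hκ
  have hκpos : 0 < κ := lt_min (by positivity) ha₀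
  have hκa : κ ≤ a₀ := min_le_right _ _
  let near : H → H → Prop := fun z u => ‖u - z‖ < m / 8 ∧ |Φ u - Φ z| < κ / 2
  have hnear_open : ∀ z, IsOpen {u | near z u} := by
    intro z
    have hΦ := hd.continuous
    have h1 : IsOpen {u : H | ‖u - z‖ < m / 8} := isOpen_lt (by fun_prop) continuous_const
    have h2 : IsOpen {u : H | |Φ u - Φ z| < κ / 2} := isOpen_lt (by fun_prop) continuous_const
    exact h1.inter h2
  have hnear_neg : ∀ z u, near z u → near (-z) (-u) := by
    rintro z u ⟨h1, h2⟩
    have e : -u - -z = -(u - z) := by abel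
    refine ⟨by rwa [e, norm_neg], by rwa [heven, heven]⟩
  have hcrit_neg : ∀ z, fderiv ℝ Φ z = 0 → fderiv ℝ Φ (-z) = 0 := fun z hz => by
    rw [fderiv_neg_of_even hd heven, hz, neg_zero]
  set O : Set H := {u | ∃ z, (fderiv ℝ Φ z = 0 ∧ 0 < Φ z) ∧ near z u} with hO
  have hOopen : IsOpen O := by
    have : O = ⋃ z ∈ {z | fderiv ℝ Φ z = 0 ∧ 0 < Φ z}, {u | near z u} := by
      ext u; simp [hO]
    rw [this]
    exact isOpen_biUnion fun z _ => hnear_open z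
  have hOneg : ∀ u, u ∈ O → -u ∈ O := by
    rintro u ⟨z, ⟨hz, hz0⟩, hzu⟩
    exact ⟨-z, ⟨hcrit_neg z hz, by rwa [heven]⟩, hnear_neg z u hzu⟩
  obtain ⟨ψ, F, σ, hF, hψ0, hψ1, hψo, hfix, hdesc, hodd⟩ := exists_descent_map
    (s := m / 4 / (1 + M + m)) (a := a₀ / 3) (a' := a₀ / 2) hd hc hg (by positivity)
    (by linarith) (by positivity) (by field_simp; rfl) hOopen
    (fun u hu hle => ⟨u, ⟨hu, by linarith⟩, by simpa [near] using ⟨hm, hκpos⟩⟩)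
  have hFodd := hodd heven hOneg
  have hiter_neg : ∀ n u, F^[n] (-u) = -F^[n] u := by
    intro n u
    induction n with
    | zero => rfl
    | succ n ih => rw [Function.iterate_succ_apply', Function.iterate_succ_apply', ih, hFodd]
  have hpos : ∀ z, fderiv ℝ Φ z = 0 → 0 < Φ z → a₀ ≤ Φ z := fun z hz hz0 =>
    hcrit z hz (by rintro rfl; rw [h0] at hz0; exact lt_irrefl _ hz0)
  have hnotwo : ∀ u z y, Φ u ≤ β → fderiv ℝ Φ z = 0 → fderiv ℝ Φ y = 0 → Φ z = Φ y → z ≠ y →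
      0 < Φ y → ∀ i k, i ≤ k → near z (F^[i] u) → near y (F^[k] u) → False := by
    intro u z y hu hz hy hzy hne hy0 i k hik hi hk
    have hOnear : ∀ u ∈ O, ∃ z, fderiv ℝ Φ z = 0 ∧ 0 < Φ z ∧ ‖u - z‖ < m / 8 := by
      rintro u ⟨z, ⟨hz, hz0⟩, hzu⟩
      exact ⟨z, hz, hz0, hzu.1⟩
    exact hF.not_visits_two hψ0 hψ1 hg (by field_simp; rfl) hδ hgδ
      (min_le_left _ _) (by positivity) hcβ hOnear
      hψo hu hz hy hzy hne hy0 (by linarith [hpos y hy hy0]) hik hi.1 hi.2 hk.1 hk.2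
  -- The well-ordering selects one of z, -z. If u and -u both belonged to the set, oddness would
  -- make the trajectory of u visit a selected point and the antipode of a selected point of the
  -- same level; these differ.
  let W₀ : ℕ → Set H := fun i => {u | ∃ (n : ℕ) (z : H), (fderiv ℝ Φ z = 0 ∧ 0 < Φ z ∧
    Φ z = cv i ∧ WellOrderingRel z (-z)) ∧ near z (F^[n] u)}
  have hW₀ : ∀ i, IsOpen (W₀ i) := by
    intro i
    have : W₀ i = ⋃ n : ℕ, ⋃ z ∈ {z | fderiv ℝ Φ z = 0 ∧ 0 < Φ z ∧ Φ z = cv i ∧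
        WellOrderingRel z (-z)}, F^[n] ⁻¹' {u | near z u} := by
      ext u
      simp only [W₀, Set.mem_iUnion, Set.mem_preimage, exists_prop]
      exact Iff.rfl
    rw [this]
    exact isOpen_iUnion fun n => isOpen_biUnion fun z _ =>
      (hnear_open z).preimage (hF.continuous.iterate n)
  have hW₀neg : ∀ i u, Φ u ≤ β → u ∈ W₀ i → -u ∉ W₀ i := by
    rintro i u hu ⟨n, z, ⟨hz, hz0, hzi, hzlt⟩, hn⟩ ⟨k, y, ⟨hy, hy0, hyi, hylt⟩, hk⟩
    have hk' : near (-y) (F^[k] u) := by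
      have := hnear_neg _ _ hk
      rwa [hiter_neg, neg_neg] at this
    have hne : z ≠ -y := by
      rintro rfl
      rw [neg_neg] at hzlt
      exact asymm_of WellOrderingRel hzlt hylt
    have hval : Φ z = Φ (-y) := by rw [heven, hzi, hyi]
    have hy0' : 0 < Φ (-y) := by rwa [heven]
    rcases le_total n k with h | h
    · exact hnotwo u z (-y) hu hz (hcrit_neg y hy) hval hne hy0' n k h hn hk'
    · exact hnotwo u (-y) z hu (hcrit_neg y hy) hz hval.symm hne.symm hz0 k n h hk' hn
  set K : Set (Fin (p + 1) → ℝ) := {x | l1 x ≤ 1} ∩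
    {x | ∃ i < p, j x ∈ W₀ i ∨ -j x ∈ W₀ i}ᶜ with hK
  have hKc : IsCompact K := by
    refine (isCompact_l1_le 1).inter_right (isClosed_compl_iff.2 ?_)
    have : {x | ∃ i < p, j x ∈ W₀ i ∨ -j x ∈ W₀ i}
        = ⋃ i ∈ {i | i < p}, (j ⁻¹' W₀ i ∪ (fun x => -j x) ⁻¹' W₀ i) := by
      ext x; simp
    rw [this]
    exact isOpen_biUnion fun i _ => ((hW₀ i).preimage hj).union ((hW₀ i).preimage hj.neg)
  obtain ⟨N, hN⟩ := hF.exists_uniform_iterate hd.continuous hψ0 (hKc.image hj) (a := a₀ / 2) (by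
    rintro _ ⟨x, ⟨hx, hxW⟩, rfl⟩
    obtain ⟨n, h | ⟨z, ⟨hz, hz0⟩, hzn⟩⟩ := hdesc _ (hjβ x hx)
    · exact ⟨n, h⟩
    · exfalso
      apply hxW
      obtain ⟨i, hi, hiz⟩ := hcv z hz
      have hzne : z ≠ -z := fun h => by
        have h2 : (2 : ℝ) • z = 0 := by
          rw [two_smul]
          nth_rewrite 2 [h]
          exact add_neg_cancel z
        rw [(smul_eq_zero.1 h2).resolve_left two_ne_zero, h0] at hz0
        exact lt_irrefl _ hz0
      refine ⟨i, hi, ?_⟩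
      rcases trichotomous_of WellOrderingRel z (-z) with h | h | h
      · exact Or.inl ⟨n, z, ⟨hz, hz0, hiz.symm, h⟩, hzn⟩
      · exact absurd h hzne
      · refine Or.inr ⟨n, -z, ⟨hcrit_neg z hz, by rwa [heven], by rw [heven, hiz],
          by rwa [neg_neg]⟩, ?_⟩
        rw [hiter_neg]
        exact hnear_neg _ _ hzn)
  have hfixN : ∀ u, Φ u ≤ a₀ / 3 → F^[N] u = u := fun u hu => Function.iterate_fixed (hfix u hu) N
  -- A zero of this function outside the cover would have energy below `a₀ / 2` after N steps, yet
  -- lie on the sphere of radius r, where the energy is at least `a₀`. The origin and the boundary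
  -- are fixed by the descent and give opposite signs.
  refine borsuk_ulam_separation (p := p) (fun i => j ⁻¹' W₀ i) (fun x => ‖F^[N] (j x)‖ - r)
    (fun i _ => (hW₀ i).preimage hj) (fun i _ x hx hxW => ?_) ?_ (fun x => ?_) (fun x hx he => ?_)
    ?_ (fun x hx => ?_)
  · rw [Set.mem_preimage, hjneg]
    exact hW₀neg i _ (hjβ x hx) hxW
  · exact ((hF.continuous.iterate N).comp hj).norm.sub continuous_const
  · rw [hjneg, hiter_neg, norm_neg]
  · by_contra hxW
    have hxK : x ∈ K := ⟨hx, fun hmem => hxW (by simpa [hjneg] using hmem)⟩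
    have h1 := hN _ ⟨x, hxK, rfl⟩
    have h2 := hsphere _ (sub_eq_zero.1 he)
    linarith
  · have : j 0 = 0 := by simp [j]
    simp only [this]
    rw [hfixN 0 (by rw [h0]; positivity), norm_zero]
    linarith
  · have := hjr x hx
    change 0 < ‖F^[N] (j x)‖ - r
    rw [hfixN _ (by linarith [hj1 x hx])]
    linarith

end Multiplicity

end StronglyIndefinite

end

/-! ### Conclusion -/

theorem theorem2p6 {H Y G : Type*}
    [NormedAddCommGroup H] [InnerProductSpace ℝ H] [CompleteSpace H]
    [NormedAddCommGroup Y] [NormedSpace ℝ Y] [CompleteSpace Y]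
    [Group G] [MulAction G (StronglyIndefinite.Space H Y)]
    (hrefl : StronglyIndefinite.IsReflexive (StronglyIndefinite.Space H Y))
    (hdim : ¬ FiniteDimensional ℝ H)
    (I : StronglyIndefinite.Space H Y → ℝ) (r : ℝ)
    (hI : StronglyIndefinite.Conditions I r)
    (hG : StronglyIndefinite.ActsDiscretely G I) :
    ((∀ ε₀ : ℝ, 0 < ε₀ → ∃ ε : ℝ, 0 < ε ∧ ε ≤ ε₀ ∧
        StronglyIndefinite.ConditionM G I 0 (StronglyIndefinite.levelM I r + ε)) →
      (∃ u, StronglyIndefinite.IsCritical I u ∧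
        StronglyIndefinite.functional I u = StronglyIndefinite.levelM I r) ∨
      (∃ c : ℕ → ℝ, (∀ n, StronglyIndefinite.IsCriticalValue I (c n) ∧
          StronglyIndefinite.levelM I r < c n) ∧
        Filter.Tendsto c Filter.atTop (nhds (StronglyIndefinite.levelM I r)))) ∧
    (((∀ β : ℝ, 0 < β → StronglyIndefinite.ConditionM G I 0 β) ∧
        (∀ u, StronglyIndefinite.functional I (-u) = StronglyIndefinite.functional I u)) →
      (StronglyIndefinite.criticalOrbits G I).Infinite) := by
  have hnt : Nontrivial H := by
    by_contra h
    rw [not_nontrivial_iff_subsingleton] at h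
    exact hdim inferInstance
  refine ⟨hI.exists_isCritical_or_tendsto hrefl, fun ⟨hM, heven⟩ hfin => ?_⟩
  obtain ⟨a, ha, hsphere⟩ := hI.exists_pos_le_reduced_of_norm_eq hrefl
  have hfin' : {c | StronglyIndefinite.IsCriticalValue I c}.Finite := hG.finite_criticalValues hfin
  -- Finitely many orbits make the set of critical values finite and also trigger part (ii) of (M)
  -- at every level β. The constant `a₀` serves both the sphere, by (I6), and the nontrivial
  -- critical points, by (I8).
  refine StronglyIndefinite.infinite_criticalValues_of_even
    (Φ := StronglyIndefinite.reduced I) (a₀ := min a (StronglyIndefinite.levelM I r))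
    (hI.differentiable_reduced hrefl) (hI.continuous_fderiv_reduced hrefl)
    (hI.reduced_neg hrefl heven) (hI.reduced_zero hrefl) hI.i6_pos
    (lt_min ha (hI.levelM_pos hrefl)) (fun u hu => (min_le_left _ _).trans (hsphere u hu))
    (fun Q hQ hQ0 => hI.exists_forall_reduced_smul_neg hrefl hQ hQ0) (fun u hu hu0 => ?_)
    (fun β hβ => (hM β hβ).exists_hasDiscreteAlmostCritical
      (hG.finite_reducedCriticalOrbits hI hrefl hfin 0 β)) hdim (hfin'.subset ?_)
  · exact (min_le_right _ _).trans (hI.levelM_le_of_isCritical hrefl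
      ((hI.isCritical_mapM_iff hrefl u).2 hu)
      fun h => hu0 (congrArg (fun w : StronglyIndefinite.Space H Y => w.fst) h))
  · rintro _ ⟨u, hu, rfl⟩
    exact ⟨StronglyIndefinite.mapM I u, (hI.isCritical_mapM_iff hrefl u).2 hu, rfl⟩
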